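/- Let $\mathbb F$ be a field. A finite ranked poset is a finite poset $Q$ with a rank function $|\cdot|:Q\to\mathbb N$ such that $|p|=0$ iff $p$ is minimal, and $|q|=|p|+1$ whenever $q$ covers $p$. Its Möbius polynomial is $\mathcal M_Q(z)=\sum_{p\le q}\mu(p,q)z^{|q|-|p|}$, where $\mu$ is the Möbius function of $Q$. For a finite poset $P$, let $E_P=\{(q,p): q\text{ covers }p\}$ be the set of edges of its Hasse diagram, the edge $(q,p)$ being directed from its tail $q$ to its head $p$. To a path $\pi=(e_1,\dots,e_m)$, $m\ge 1$ (the head of $e_i$ is the tail of $e_{i+1}$), associate the polynomial $(t-e_1)\cdots(t-e_m)=\sum_i e(\pi,i)t^i$ over the free algebra $\mathbb F\langle E_P\rangle$, with $t$ central. The splitting algebra $A(P)$ is the quotient of $\mathbb F\langle E_P\rangle$ by the two-sided ideal generated by all $e(\pi_1,i)-e(\pi_2,i)$, where $i\ge 0$ and $\pi_1,\pi_2$ are paths from the same vertex to the same vertex; it is graded by $A(P)_i$ = image of the span of the words of length $i$. An automorphism $\sigma$ of $P$ induces the graded automorphism $(q,p)\mapsto(\sigma q,\sigma p)$ of $A(P)$,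 and $Tr_\sigma(A(P),z)=\sum_{i\ge0}\operatorname{Tr}(\sigma|_{A(P)_i})z^i\in\mathbb F[[z]]$. Let $Q_1,\dots,Q_n$ be finite ranked posets, each with a unique minimal element, and let $P=\prod_{k=1}^nQ_k$ with the componentwise order. Suppose that certain of the factors are regarded as copies of one another: there are an equivalence relation $\sim$ on $\{1,\dots,n\}$ and poset isomorphisms $\varphi_{kl}:Q_k\to Q_l$ for $k\sim l$, with $\varphi_{kk}=\mathrm{id}$ and $\varphi_{lm}\varphi_{kl}=\varphi_{km}$. Let $\sigma\in S_n$ satisfy $\sigma(k)\sim k$ for all $k$, and denote by $\sigma$ also the corresponding factor-shuffling automorphism of $P$, given by $(\sigma x)_{\sigma(k)}=\varphi_{k,\sigma(k)}(x_k)$. Let $\sigma=\sigma_1\cdots\sigma_r$ be the cycle decomposition of $\sigma$ in $S_n$, cycles of length $1$ included, let $i_j$ be the length of $\sigma_j$, and let $Q_{k_j}$ be any one of the (mutually isomorphic) factors permuted by $\sigma_j$. Then, in $\mathbb F[[z]]$, $$Tr_\sigma(A(P),z)=\frac{1-z}{1-z\prod_{j=1}^r\mathcal M_{Q_{k_j}}\left(z^{i_j}\right)}.$$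 -/

import Mathlib

universe u v

/-- A rank function on a poset: it vanishes exactly at the minimal elements, and it increases by
one along every covering relation. -/
structure IsRankFunction {P : Type u} [PartialOrder P] (ρ : P → ℕ) : Prop where
  eq_zero_iff : ∀ p, ρ p = 0 ↔ IsMin p
  covBy : ∀ p q, p ⋖ q → ρ q = ρ p + 1

open Classical in
/-- The Möbius polynomial `∑_{p ≤ q} μ(p,q) z^(|q| - |p|)` of a finite poset with (generalized)
rank function `ρ`. -/
noncomputable def mobiusPoly {P : Type u} [PartialOrder P] [Fintype P] (ρ : P → ℕ) :
    Polynomial ℤ :=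
  letI : LocallyFiniteOrder P := Fintype.toLocallyFiniteOrder
  ∑ p : P, ∑ q : P,
    if p ≤ q then
      Polynomial.C (IncidenceAlgebra.mu ℤ (α := P) p q) * Polynomial.X ^ (ρ q - ρ p)
    else 0

/-! ### The splitting algebra of a poset -/

/-- The edges `(q, p)`, `p ⋖ q`, of the Hasse diagram, directed from `q` to `p`. -/
abbrev HasseEdge (P : Type u) [PartialOrder P] : Type u := {e : P × P // e.2 ⋖ e.1}

namespace HasseEdge

variable {P : Type u} [PartialOrder P]

/-- The tail `q` of the edge `(q, p)`. -/
def tail (e : HasseEdge P) : P := e.1.1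

/-- The head `p` of the edge `(q, p)`. -/
def head (e : HasseEdge P) : P := e.1.2

/-- The action of a poset automorphism on the edges of the Hasse diagram. -/
def map (f : P ≃o P) (e : HasseEdge P) : HasseEdge P :=
  ⟨(f e.1.1, f e.1.2), (apply_covBy_apply_iff f).2 e.2⟩

end HasseEdge

/-- A path in the Hasse diagram: a nonempty tuple of edges, each edge starting where the previous
one ends. -/
structure HassePath (P : Type u) [PartialOrder P] where
  edges : List (HasseEdge P)
  ne_nil : edges ≠ []
  chain : edges.IsChain (fun e e' => e.head = e'.tail)

namespace HassePath

variable {P : Type u} [PartialOrder P]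

/-- The tail of a path is the tail of its first edge. -/
def tail (π : HassePath P) : P := (π.edges.head π.ne_nil).tail

/-- The head of a path is the head of its last edge. -/
def head (π : HassePath P) : P := (π.edges.getLast π.ne_nil).head

/-- The polynomial `(t - e₁)(t - e₂)⋯(t - eₙ)` of a path, with coefficients in the free algebra on
the edges (the variable `t` is central). -/
noncomputable def poly (F : Type v) [Field F] (π : HassePath P) :
    Polynomial (FreeAlgebra F (HasseEdge P)) :=
  (π.edges.map fun e => Polynomial.X - Polynomial.C (FreeAlgebra.ι F e)).prod

/-- The action of a poset automorphism on paths. -/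
def map (f : P ≃o P) (π : HassePath P) : HassePath P where
  edges := π.edges.map (HasseEdge.map f)
  ne_nil := by simpa using π.ne_nil
  chain := by
    rw [List.isChain_map]
    exact π.chain.imp fun a b h => congrArg f h

theorem tail_map (f : P ≃o P) (π : HassePath P) : (π.map f).tail = f π.tail := by
  simp [tail, map, HasseEdge.tail, HasseEdge.map]

theorem head_map (f : P ≃o P) (π : HassePath P) : (π.map f).head = f π.head := by
  simp [head, map, HasseEdge.head, HasseEdge.map]

end HassePath

/-- The defining relations of the splitting algebra: corresponding coefficients of the polynomials
of two paths with the same tail and the same head are identified. -/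
inductive SplittingRel (F : Type v) [Field F] (P : Type u) [PartialOrder P] :
    FreeAlgebra F (HasseEdge P) → FreeAlgebra F (HasseEdge P) → Prop
  | coeff (π₁ π₂ : HassePath P) (htail : π₁.tail = π₂.tail) (hhead : π₁.head = π₂.head) (i : ℕ) :
      SplittingRel F P ((π₁.poly F).coeff i) ((π₂.poly F).coeff i)

/-- The splitting algebra `A(P)`: the quotient of the free algebra on the edges of the Hasse
diagram by the two-sided ideal generated by the defining relations. -/
abbrev SplittingAlgebra (F : Type v) [Field F] (P : Type u) [PartialOrder P] : Type (max u v) :=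
  RingQuot (SplittingRel F P)

namespace SplittingAlgebra

variable (F : Type v) [Field F] {P : Type u} [PartialOrder P]

/-- The degree `i` component of the free algebra on a type: the span of the words of length `i`. -/
def freeDegree (E : Type u) (i : ℕ) : Submodule F (FreeAlgebra F E) :=
  Submodule.span F {w | ∃ l : List E, l.length = i ∧ w = (l.map (FreeAlgebra.ι F)).prod}

variable (P) in
/-- The degree `i` component of `A(P)`, for the grading inherited from the free algebra. -/
def degree (i : ℕ) : Submodule F (SplittingAlgebra F P) :=
  (freeDegree F (HasseEdge P) i).map (RingQuot.mkAlgHom F (SplittingRel F P)).toLinearMap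

/-- The components of `A(P)` are finite-dimensional when `P` is finite. -/
instance [Finite P] (i : ℕ) : Module.Finite F (degree F P i) := by
  have hfin : {w | ∃ l : List (HasseEdge P), l.length = i ∧
      w = (l.map (FreeAlgebra.ι F)).prod}.Finite := by
    refine ((List.finite_length_eq (HasseEdge P) i).image
      fun l => (l.map (FreeAlgebra.ι F)).prod).subset ?_
    rintro w ⟨l, hl, rfl⟩
    exact ⟨l, hl, rfl⟩
  have : Module.Finite F (freeDegree F (HasseEdge P) i) :=
    Module.Finite.span_of_finite F hfin
  unfold degree
  infer_instance

/-- The endomorphism of the free algebra induced by a poset automorphism. -/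
noncomputable def freeMap (f : P ≃o P) :
    FreeAlgebra F (HasseEdge P) →ₐ[F] FreeAlgebra F (HasseEdge P) :=
  FreeAlgebra.lift F fun e => FreeAlgebra.ι F (HasseEdge.map f e)

theorem poly_map (f : P ≃o P) (π : HassePath P) :
    (π.map f).poly F = (π.poly F).map (freeMap F f : _ →+* _) := by
  simp only [HassePath.poly, HassePath.map]
  rw [← Polynomial.coe_mapRingHom, map_list_prod, List.map_map, List.map_map]
  congr 1
  refine List.map_congr_left fun e _ => ?_
  simp [freeMap]

/-- The algebra endomorphism of `A(P)` sending the edge `(q, p)` to `(f q, f p)`. -/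
noncomputable def mapHom (f : P ≃o P) : SplittingAlgebra F P →ₐ[F] SplittingAlgebra F P :=
  RingQuot.liftAlgHom F ⟨(RingQuot.mkAlgHom F (SplittingRel F P)).comp (freeMap F f), by
    rintro _ _ ⟨π₁, π₂, ht, hh, i⟩
    have key := RingQuot.mkAlgHom_rel F (SplittingRel.coeff (F := F) (π₁.map f) (π₂.map f)
      (by rw [HassePath.tail_map, HassePath.tail_map, ht])
      (by rw [HassePath.head_map, HassePath.head_map, hh]) i)
    rw [poly_map, poly_map, Polynomial.coeff_map, Polynomial.coeff_map] at key
    exact key⟩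

theorem mapHom_mk (f : P ≃o P) (x : FreeAlgebra F (HasseEdge P)) :
    mapHom F f (RingQuot.mkAlgHom F (SplittingRel F P) x) =
      RingQuot.mkAlgHom F (SplittingRel F P) (freeMap F f x) := by
  simp [mapHom]

theorem mapHom_comp_of_inverse (f g : P ≃o P) (h : ∀ p, f (g p) = p) :
    (mapHom F f).comp (mapHom F g) = AlgHom.id F _ := by
  apply RingQuot.ringQuot_ext'
  ext e
  simp [mapHom_mk, freeMap, HasseEdge.map, h]

/-- The algebra automorphism of `A(P)` induced by an automorphism of the poset `P`. -/
noncomputable def mapEquiv (f : P ≃o P) : SplittingAlgebra F P ≃ₐ[F] SplittingAlgebra F P :=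
  AlgEquiv.ofAlgHom (mapHom F f) (mapHom F f.symm)
    (mapHom_comp_of_inverse F f f.symm f.apply_symm_apply)
    (mapHom_comp_of_inverse F f.symm f f.symm_apply_apply)

/-- The induced automorphism is graded. -/
theorem mapEquiv_mem_degree (f : P ≃o P) (i : ℕ) :
    ∀ x ∈ degree F P i, (mapEquiv F f).toLinearMap x ∈ degree F P i := by
  rintro _ ⟨w, hw, rfl⟩
  refine ⟨freeMap F f w, ?_, (mapHom_mk F f w).symm⟩
  refine (Submodule.span_le (p := (freeDegree F (HasseEdge P) i).comap
    (freeMap F f).toLinearMap)).2 ?_ hw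
  rintro _ ⟨l, hl, rfl⟩
  refine Submodule.subset_span ⟨l.map (HasseEdge.map f), by simpa using hl, ?_⟩
  simp only [AlgHom.toLinearMap_apply, map_list_prod, List.map_map]
  congr 1
  refine List.map_congr_left fun e _ => ?_
  simp [freeMap]

/-- The graded trace generating function `∑ᵢ Tr(f | A(P)ᵢ) zⁱ` of the automorphism of `A(P)`
induced by the automorphism `f` of `P`. -/
noncomputable def gradedTrace (f : P ≃o P) : PowerSeries F :=
  PowerSeries.mk fun i =>
    LinearMap.trace F (degree F P i)
      ((mapEquiv F f).toLinearMap.restrict (mapEquiv_mem_degree F f i))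

end SplittingAlgebra

/-! ### Factor-shuffling automorphisms -/

/-- A specification of which factors of the product of `Q₁, …, Qₙ` are regarded as copies of one
another: an equivalence relation on the indices, and identifications between the factors with
equivalent indices that are compatible with each other. -/
structure CopySystem {n : ℕ} (Q : Fin n → Type u) [∀ k, PartialOrder (Q k)] where
  same : Setoid (Fin n)
  iso : ∀ {i j : Fin n}, same i j → Q i ≃o Q j
  iso_refl : ∀ i : Fin n, iso (same.refl i) = OrderIso.refl (Q i)
  iso_trans : ∀ {i j k : Fin n} (hij : same i j) (hjk : same j k),
    (iso hij).trans (iso hjk) = iso (same.trans hij hjk)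

namespace CopySystem

variable {n : ℕ} {Q : Fin n → Type u} [∀ k, PartialOrder (Q k)] (C : CopySystem Q)

/-- The subgroup of the symmetric group of those permutations that permute copies of the same
factor among themselves. -/
def shuffles : Subgroup (Equiv.Perm (Fin n)) where
  carrier := {σ | ∀ k, C.same k (σ k)}
  one_mem' k := C.same.refl k
  mul_mem' {σ τ} hσ hτ k := C.same.trans (hτ k) (hσ (τ k))
  inv_mem' {σ} hσ k := C.same.symm (by simpa using hσ (σ⁻¹ k))

theorem same_apply (σ : C.shuffles) (k : Fin n) : C.same k (σ.1 k) := σ.2 k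

theorem same_inv (σ : C.shuffles) (k : Fin n) : C.same (σ.1⁻¹ k) k := by
  simpa using σ.2 (σ.1⁻¹ k)

theorem iso_iso {i j k : Fin n} (hij : C.same i j) (hjk : C.same j k) (x : Q i) :
    C.iso hjk (C.iso hij x) = C.iso (C.same.trans hij hjk) x := by
  rw [← C.iso_trans hij hjk]; rfl

theorem iso_apply_eq {i j : Fin n} (h : C.same i j) (e : i = j) (x : ∀ k, Q k) :
    C.iso h (x i) = x j := by
  subst e
  exact congrArg (fun g : Q i ≃o Q i => g (x i)) (C.iso_refl i)

/-- The factor-shuffling automorphism of the product: `σ` moves the `k`-th coordinate to the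
coordinate `σ k`. -/
def shuffle (σ : C.shuffles) : (∀ k, Q k) ≃o (∀ k, Q k) where
  toFun x k := C.iso (C.same_inv σ k) (x (σ.1⁻¹ k))
  invFun x k := C.iso (C.same.symm (C.same_apply σ k)) (x (σ.1 k))
  left_inv x := by
    funext k
    refine (C.iso_iso _ _ _).trans ?_
    exact C.iso_apply_eq _ (by simp) x
  right_inv x := by
    funext k
    refine (C.iso_iso _ _ _).trans ?_
    exact C.iso_apply_eq _ (by simp) x
  map_rel_iff' {x y} := by
    constructor
    · intro h k
      have hk : ∀ m, σ.1⁻¹ m = k → x k ≤ y k := by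
        rintro m rfl
        exact (C.iso (C.same_inv σ m)).le_iff_le.1 (h m)
      exact hk (σ.1 k) (by simp)
    · intro h k
      exact (C.iso (C.same_inv σ k)).monotone (h _)

theorem shuffle_apply (σ : C.shuffles) (x : ∀ k, Q k) (k : Fin n) :
    C.shuffle σ x (σ.1 k) = C.iso (C.same_apply σ k) (x k) := by
  have h : ∀ m (hm : m = k) (h : C.same m (σ.1 k)), C.iso h (x m) = C.iso (C.same_apply σ k) (x k) := by
    rintro m rfl _; rfl
  exact h _ (by simp) _

end CopySystem

/-! Let `P` have a least element, and let `P_v(t)` be the polynomial over `A(P)` of any path from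
`v` down to it, so that `P_u = (t - e) P_w` for an edge `e` from `u` to `w`. A letter `(v, k)`
stands for the coefficient of `t ^ (ρ v - k)` in `P_v`. The core of the proof is that the monomials
of the normal words form a basis of `A(P)` (`wordBasis`).

For this, `A(P)` is made to act from the right on the span of the normal words. In the free
`F[X]`-module on these words, let `N_v` be generated by the formal polynomials `∑ₖ m(u, k) X ^ (ρ u
- k)` with `u ≥ v` and `u` admissible after `m`. A triangularity argument shows that `N_v` is a
complement of the elements of degree below `ρ v` (`isMonic_relSubmodule`), hence the image of a
monic operator polynomial `M_v`. If `u` covers `w`, then `N_u ≤ N_w`, so `M_u` is `M_w` composed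
with a linear factor `X - r`; the edge acts by `r`. Injectivity of `M_w` makes the coefficients
along a path depend only on its ends, so the action descends to `A(P)` (`act`). Acting on the empty
word inverts the map from words to monomials (`ofWords_toWords`, `toWords_wordMonomial`).

An automorphism permutes this homogeneous basis, so its graded trace counts the normal words whose
vertices are all fixed (`coeff_gradedTrace`). Let `H` be the series of these words and `G_s` that of
those that `s` may follow. Sorting by the last letter gives `H = ∑_{s ≥ r} X ^ (ρ s - ρ r) G_s` for
every fixed `r`, and `H = 1 + ∑ₛ (X + ⋯ + X ^ ρ s) G_s`. Inverting the first system by Möbius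
inversion and substituting into the second gives `H (1 - X M) = 1 - X`, with `M` the sum of the
entries of the inverse matrix (`wordSeries_mul_eq`).

For a factor shuffle the fixed points are a product with one factor per cycle, embedded diagonally,
and ranks in that factor are multiplied by the cycle length (`range_diagonal`, `rank_diagonal`). The
weighted zeta matrix is then a product over the cycles, and so is `M`. -/

/-! ### Submodules of free polynomial modules with a monic complement -/

namespace MonicComplement

open Polynomial

variable {F : Type*} [Field F] {W : Type*}

/-- The elements of `W →₀ F[X]` all of whose coordinates have degree less than `d`. -/
def degLT (F : Type*) [Field F] (W : Type*) (d : ℕ) : Submodule F (W →₀ F[X]) where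
  carrier := {x | ∀ w i, d ≤ i → (x w).coeff i = 0}
  add_mem' hx hy w i hi := by simp [hx w i hi, hy w i hi]
  zero_mem' w i _ := by simp
  smul_mem' c x hx w i hi := by simp [hx w i hi]

theorem degLT_mono {d e : ℕ} (h : d ≤ e) : degLT F W d ≤ degLT F W e :=
  fun _ hx w i hi => hx w i (h.trans hi)

theorem eq_zero_of_mem_degLT_zero {x : W →₀ F[X]} (hx : x ∈ degLT F W 0) : x = 0 := by
  ext w i
  simpa using hx w i (Nat.zero_le i)

theorem exists_mem_degLT (x : W →₀ F[X]) : ∃ d, x ∈ degLT F W d := by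
  refine ⟨x.support.sup (fun w => (x w).natDegree + 1), fun w i hi => ?_⟩
  by_cases hw : x w = 0
  · simp [hw]
  · have h := Finset.le_sup (f := fun w => (x w).natDegree + 1) (Finsupp.mem_support_iff.2 hw)
    exact coeff_eq_zero_of_natDegree_lt (lt_of_lt_of_le (Nat.lt_succ_self _) (h.trans hi))

theorem smul_mem_degLT {d i : ℕ} {p : F[X]} (hp : ∀ j, i + 1 ≤ j → p.coeff j = 0)
    {x : W →₀ F[X]} (hx : x ∈ degLT F W d) : p • x ∈ degLT F W (d + i) := by
  intro w j hj
  rw [Finsupp.smul_apply, smul_eq_mul, coeff_mul]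
  refine Finset.sum_eq_zero fun a ha => ?_
  rw [Finset.HasAntidiagonal.mem_antidiagonal] at ha
  by_cases h : i + 1 ≤ a.1
  · rw [hp _ h, zero_mul]
  · rw [hx w a.2 (by omega), mul_zero]

theorem X_pow_smul_mem_degLT {d i : ℕ} {x : W →₀ F[X]} :
    (X ^ d : F[X]) • x ∈ degLT F W (d + i) ↔ x ∈ degLT F W i := by
  constructor
  · intro h w j hj
    have := h w (j + d) (by omega)
    rwa [Finsupp.smul_apply, smul_eq_mul, coeff_X_pow_mul] at this
  · intro h w j hj
    obtain ⟨k, rfl⟩ := Nat.exists_eq_add_of_le' (show d ≤ j by omega)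
    rw [Finsupp.smul_apply, smul_eq_mul, coeff_X_pow_mul]
    exact h w k (by omega)

/-- The inclusion of the constants. -/
noncomputable def const : (W →₀ F) →ₗ[F] (W →₀ F[X]) :=
  Finsupp.mapRange.linearMap (Algebra.linearMap F F[X])

/-- The coefficient of `X ^ i`. -/
noncomputable def coeffAt (i : ℕ) : (W →₀ F[X]) →ₗ[F] (W →₀ F) :=
  Finsupp.mapRange.linearMap (lcoeff F i)

@[simp] theorem const_apply (m : W →₀ F) (w : W) : const m w = C (m w) := rfl

@[simp] theorem coeffAt_apply (i : ℕ) (x : W →₀ F[X]) (w : W) :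
    coeffAt i x w = (x w).coeff i := rfl

theorem const_single (w : W) : const (Finsupp.single w (1 : F)) = Finsupp.single w 1 := by
  simp [const]

theorem const_smul (a : F) (m : W →₀ F) : const (a • m) = (C a : F[X]) • const m := by
  ext w : 1
  simp

theorem const_mem_degLT (m : W →₀ F) : const m ∈ degLT F W 1 := by
  intro w i hi
  rw [const_apply, coeff_C_of_ne_zero (by omega)]

theorem exists_const_of_mem_degLT {x : W →₀ F[X]} (hx : x ∈ degLT F W 1) :
    ∃ m, const m = x := by
  refine ⟨coeffAt 0 x, ?_⟩
  ext w i
  rcases i with _ | i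
  · simp
  · simp [hx w (i + 1) (by omega)]

theorem coeffAt_const (i : ℕ) (m : W →₀ F) :
    coeffAt i (const m) = if i = 0 then m else 0 := by
  ext w
  split_ifs with h <;> simp [coeff_C, h]

theorem coeffAt_zero_X_smul (x : W →₀ F[X]) : coeffAt 0 ((X : F[X]) • x) = 0 := by
  ext w
  simp

theorem coeffAt_succ_X_smul (i : ℕ) (x : W →₀ F[X]) :
    coeffAt (i + 1) ((X : F[X]) • x) = coeffAt i x := by
  ext w
  simp

/-- `N` is a complement of the elements of degree less than `d`. -/
structure IsMonic (N : Submodule F[X] (W →₀ F[X])) (d : ℕ) : Prop where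
  exists_sub_mem : ∀ w, ∃ y ∈ N, y - Finsupp.single w (X ^ d) ∈ degLT F W d
  eq_zero : ∀ y ∈ N, y ∈ degLT F W d → y = 0

namespace IsMonic

variable {N : Submodule F[X] (W →₀ F[X])} {d : ℕ} (hN : IsMonic N d)

/-- The operator of multiplication by the monic operator polynomial whose image is `N`. -/
noncomputable def mul : (W →₀ F[X]) →ₗ[F[X]] (W →₀ F[X]) :=
  Finsupp.linearCombination F[X] fun w => (hN.exists_sub_mem w).choose

theorem mul_single (w : W) : hN.mul (Finsupp.single w 1) = (hN.exists_sub_mem w).choose := by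
  simp [mul]

theorem mul_mem (x : W →₀ F[X]) : hN.mul x ∈ N := by
  rw [mul, Finsupp.linearCombination_apply]
  exact Submodule.sum_mem _ fun w _ =>
    N.smul_mem _ (hN.exists_sub_mem w).choose_spec.1

/-- The operator has leading term `X ^ d` times the identity; this is the sense in which it is
monic. -/
theorem mul_sub_mem {i : ℕ} {x : W →₀ F[X]} (hx : x ∈ degLT F W (i + 1)) :
    hN.mul x - (X ^ d : F[X]) • x ∈ degLT F W (d + i) := by
  have h : hN.mul x - (X ^ d : F[X]) • x =
      ∑ w ∈ x.support, x w • ((hN.exists_sub_mem w).choose - Finsupp.single w (X ^ d)) := by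
    simp_rw [smul_sub, Finset.sum_sub_distrib]
    congr 1
    conv_lhs => rw [← Finsupp.sum_single x, Finsupp.sum, Finset.smul_sum]
    refine Finset.sum_congr rfl fun w _ => ?_
    simp [mul_comm]
  rw [h]
  exact Submodule.sum_mem _ fun w _ =>
    smul_mem_degLT (hx w) (hN.exists_sub_mem w).choose_spec.2

/-- Leading terms of a monic operator cannot cancel, so the bound on the degree can be lowered one
step at a time. -/
theorem mem_degLT_of_mul_mem {i : ℕ} {x : W →₀ F[X]} (hx : hN.mul x ∈ degLT F W (d + i)) :
    x ∈ degLT F W i := by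
  obtain ⟨e, he⟩ := exists_mem_degLT x
  obtain hle | hle := le_total e i
  · exact degLT_mono hle he
  · refine Nat.decreasingInduction' (P := fun k => x ∈ degLT F W k) (fun k _ hk hx' => ?_) hle he
    have h1 := hN.mul_sub_mem hx'
    have h2 := sub_mem (degLT_mono (by omega : d + i ≤ d + k) hx) h1
    rw [sub_sub_cancel] at h2
    exact X_pow_smul_mem_degLT.1 h2

theorem mul_injective : Function.Injective hN.mul := by
  rw [injective_iff_map_eq_zero]
  intro x hx
  refine eq_zero_of_mem_degLT_zero (hN.mem_degLT_of_mul_mem ?_)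
  rw [hx]
  exact zero_mem _

/-- Division by a monic operator: leading terms are removed until the remainder, still in `N`, has
degree below `d` and therefore vanishes. -/
theorem exists_mul_eq {y : W →₀ F[X]} (hy : y ∈ N) : ∃ x, hN.mul x = y := by
  suffices ∀ i, ∀ y ∈ N, y ∈ degLT F W (d + i) → ∃ x, hN.mul x = y by
    obtain ⟨e, he⟩ := exists_mem_degLT y
    exact this e y hy (degLT_mono (by omega) he)
  intro i
  induction i with
  | zero => exact fun y hy hd => ⟨0, by rw [map_zero, hN.eq_zero y hy hd]⟩
  | succ i ih =>
    intro y hy hd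
    -- The leading coefficient of `y`, shifted so that the operator restores it in degree `d + i`.
    let x₁ : W →₀ F[X] := (X ^ i : F[X]) • const (coeffAt (d + i) y)
    have hx₁ : x₁ ∈ degLT F W (i + 1) := X_pow_smul_mem_degLT.2 (const_mem_degLT _)
    have h1 : y - (X ^ d : F[X]) • x₁ ∈ degLT F W (d + i) := by
      intro w j hj
      have : ((X ^ d : F[X]) • x₁) w = C ((y w).coeff (d + i)) * X ^ (d + i) := by
        simp only [x₁, Finsupp.smul_apply, const_apply, coeffAt_apply, smul_eq_mul]
        ring
      rw [Finsupp.sub_apply, this, coeff_sub, coeff_C_mul_X_pow]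
      split_ifs with h
      · rw [h, sub_self]
      · rw [hd w j (by omega), sub_zero]
    obtain ⟨x₂, hx₂⟩ := ih (y - hN.mul x₁) (sub_mem hy (hN.mul_mem _)) (by
      have := sub_mem h1 (hN.mul_sub_mem hx₁)
      rwa [sub_sub_sub_cancel_right] at this)
    exact ⟨x₂ + x₁, by rw [map_add, hx₂, sub_add_cancel]⟩

/-- Two elements of `N` with the same leading term differ by an element of `N` of degree below `d`.
The arbitrary choice in `mul` is thus no choice, and explicit values can be computed. -/
theorem mul_single_eq {w : W} {y : W →₀ F[X]} (hy : y ∈ N)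
    (hd : y - Finsupp.single w (X ^ d) ∈ degLT F W d) : hN.mul (Finsupp.single w 1) = y := by
  have h := hN.mul_sub_mem (i := 0) (x := Finsupp.single w 1)
    (by rw [← const_single]; exact const_mem_degLT _)
  rw [Finsupp.smul_single, smul_eq_mul, mul_one] at h
  refine sub_eq_zero.1 (hN.eq_zero _ (sub_mem (hN.mul_mem _) hy) ?_)
  have := sub_mem h hd
  rwa [sub_sub_sub_cancel_right] at this

theorem mul_eq_self (hN : IsMonic N 0) (x : W →₀ F[X]) : hN.mul x = x := by
  have h : ∀ w, hN.mul (Finsupp.single w 1) = Finsupp.single w 1 := fun w =>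
    sub_eq_zero.1 (eq_zero_of_mem_degLT_zero
      (by simpa [hN.mul_single w] using (hN.exists_sub_mem w).choose_spec.2))
  have : hN.mul = LinearMap.id := by
    refine Finsupp.lhom_ext' fun w => LinearMap.ext_ring ?_
    exact h w
  rw [this, LinearMap.id_apply]

/-- Containment of submodules whose degrees differ by one gives a linear right factor. -/
theorem exists_linear_factor {N' : Submodule F[X] (W →₀ F[X])} {d' : ℕ} (hN' : IsMonic N' d')
    (hd : d' = d + 1) (hle : N' ≤ N) (w : W) : ∃ r : W →₀ F, hN'.mul (Finsupp.single w 1) =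
      hN.mul ((X : F[X]) • Finsupp.single w 1 - const r) := by
  subst hd
  obtain ⟨x, hx⟩ := hN.exists_mul_eq (hle (hN'.mul_mem (Finsupp.single w 1)))
  have hs : Finsupp.single w (1 : F[X]) ∈ degLT F W 1 := by
    rw [← const_single]; exact const_mem_degLT _
  have h1 := hN'.mul_sub_mem (i := 0) hs
  have h2 := hN.mul_sub_mem (i := 1) (x := (X : F[X]) • Finsupp.single w 1)
    (by simpa using (X_pow_smul_mem_degLT (d := 1) (i := 1)).2 hs)
  -- Both images have leading term `X ^ (d + 1)` at `w`, so the difference of their preimages has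
  -- degree below `1`: it is the constant `r`.
  have h3 : hN.mul ((X : F[X]) • Finsupp.single w 1 - x) ∈ degLT F W (d + 1) := by
    rw [map_sub, hx]
    have := sub_mem h2 h1
    rwa [smul_smul, ← pow_succ, sub_sub_sub_cancel_right] at this
  obtain ⟨r, hr⟩ := exists_const_of_mem_degLT (hN.mem_degLT_of_mul_mem h3)
  exact ⟨r, by rw [hr, sub_sub_cancel, hx]⟩

end IsMonic

end MonicComplement

/-! ### Normal words -/

namespace HasseWord

open Polynomial MonicComplement

variable {P : Type u} [PartialOrder P] (ρ : P → ℕ)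

/-- The letters that may follow a word; words are stored with their last letter first. -/
def Admissible : List (P × ℕ) → P → Prop
  | [], _ => True
  | a :: _, v => ¬ (v < a.1 ∧ a.2 + ρ v = ρ a.1)

/-- A word in letters `(v, k)`, `1 ≤ k ≤ ρ v`, is normal if no letter `(u, j)` in it is followed by
a letter `(v, k)` with `v < u` and `j = ρ u - ρ v`. -/
def IsNormal : List (P × ℕ) → Prop
  | [] => True
  | a :: l => IsNormal l ∧ Admissible ρ l a.1 ∧ 1 ≤ a.2 ∧ a.2 ≤ ρ a.1

/-- The normal words. -/
abbrev Word : Type u := {l : List (P × ℕ) // IsNormal ρ l}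

namespace Word

variable {ρ}

open Classical in
/-- The word `m` followed by the letter `(v, k)`; it is `m` itself when this is not normal, in
particular for `k = 0`. -/
noncomputable def snoc (m : Word ρ) (v : P) (k : ℕ) : Word ρ :=
  if h : Admissible ρ m.1 v ∧ 1 ≤ k ∧ k ≤ ρ v then ⟨(v, k) :: m.1, m.2, h⟩ else m

theorem snoc_zero (m : Word ρ) (v : P) : m.snoc v 0 = m := by simp [snoc]

theorem snoc_val {m : Word ρ} {v : P} {k : ℕ} (h : Admissible ρ m.1 v) (h1 : 1 ≤ k)
    (hk : k ≤ ρ v) : (m.snoc v k).1 = (v, k) :: m.1 := by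
  simp [snoc, h, h1, hk]

theorem snoc_mk {l : List (P × ℕ)} {a : P × ℕ} (h : IsNormal ρ (a :: l)) :
    snoc ⟨l, h.1⟩ a.1 a.2 = ⟨a :: l, h⟩ :=
  Subtype.ext (snoc_val h.2.1 h.2.2.1 h.2.2.2)

theorem snoc_injOn {m : Word ρ} {v : P} (h : Admissible ρ m.1 v) {k k' : ℕ} (hk : k ≤ ρ v)
    (hk' : k' ≤ ρ v) (he : m.snoc v k = m.snoc v k') : k = k' := by
  have he' := congrArg Subtype.val he
  rcases Nat.eq_zero_or_pos k with rfl | h1 <;> rcases Nat.eq_zero_or_pos k' with rfl | h1'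
  · rfl
  · rw [snoc_zero, snoc_val h h1' hk'] at he'
    exact absurd (congrArg List.length he') (by simp)
  · rw [snoc_zero, snoc_val h h1 hk] at he'
    exact absurd (congrArg List.length he') (by simp)
  · rw [snoc_val h h1 hk, snoc_val h h1' hk'] at he'
    simpa using he'

theorem admissible_snoc {m : Word ρ} {u v : P} {k : ℕ} (h : Admissible ρ m.1 u) (h1 : 1 ≤ k)
    (hk : k ≤ ρ u) (hv : v < u → k + ρ v ≠ ρ u) : Admissible ρ (m.snoc u k).1 v := by
  rw [snoc_val h h1 hk]
  exact fun hc => hv hc.1 hc.2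

variable (F : Type v) [Field F]

/-- The element `∑ₖ m(v, k) X ^ (ρ v - k)`. -/
noncomputable def gen (m : Word ρ) (v : P) : Word ρ →₀ F[X] :=
  ∑ k ∈ Finset.range (ρ v + 1), Finsupp.single (m.snoc v k) (X ^ (ρ v - k))

theorem gen_snoc {m : Word ρ} {v : P} (h : Admissible ρ m.1 v) {k : ℕ} (hk : k ≤ ρ v) :
    gen F m v (m.snoc v k) = X ^ (ρ v - k) := by
  classical
  rw [gen, Finsupp.finsetSum_apply, Finset.sum_eq_single k]
  · simp
  · intro j hj hjk
    rw [Finsupp.single_apply, if_neg]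
    exact fun he => hjk (snoc_injOn h (by simpa [Nat.lt_succ_iff] using hj) hk he)
  · intro hk'
    exact absurd (Finset.mem_range.2 (Nat.lt_succ_of_le hk)) hk'

theorem gen_self {m : Word ρ} {v : P} (h : Admissible ρ m.1 v) :
    gen F m v m = X ^ ρ v := by
  simpa [snoc_zero] using gen_snoc F h (Nat.zero_le _)

theorem exists_snoc_of_gen_ne_zero {m w : Word ρ} {v : P} (h : gen F m v w ≠ 0) :
    ∃ k ≤ ρ v, w = m.snoc v k := by
  classical
  by_contra! hc
  refine h ?_
  rw [gen, Finsupp.finsetSum_apply]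
  refine Finset.sum_eq_zero fun k hk => ?_
  rw [Finsupp.single_apply, if_neg]
  exact fun he => hc k (by simpa [Nat.lt_succ_iff] using hk) he.symm

theorem coeffAt_gen {m : Word ρ} {v : P} {k : ℕ} (hk : k ≤ ρ v) :
    coeffAt (ρ v - k) (gen F m v) = Finsupp.single (m.snoc v k) 1 := by
  rw [gen, map_sum, Finset.sum_eq_single k]
  · simp [coeffAt]
  · intro j hj hjk
    have := Finset.mem_range.1 hj
    simp only [coeffAt, Finsupp.mapRange.linearMap_apply, Finsupp.mapRange_single, lcoeff_apply,
      coeff_X_pow]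
    rw [if_neg (by omega), Finsupp.single_zero]
  · intro h
    exact absurd (Finset.mem_range.2 (Nat.lt_succ_of_le hk)) h

/-- The submodule attached to a vertex. -/
noncomputable def relSubmodule (ρ : P → ℕ) (v : P) : Submodule F[X] (Word ρ →₀ F[X]) :=
  Submodule.span F[X] {x | ∃ (m : Word ρ) (u : P), v ≤ u ∧ Admissible ρ m.1 u ∧ gen F m u = x}

variable {F}

/-- Generators for all vertices above `v` are included precisely to obtain this inclusion, the
counterpart of `P_v` being a right divisor of `P_w` for `w` above `v`. -/
theorem relSubmodule_antitone {v w : P} (h : w ≤ v) :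
    relSubmodule F ρ v ≤ relSubmodule F ρ w := by
  refine Submodule.span_mono ?_
  rintro x ⟨m, u, hu, hm, rfl⟩
  exact ⟨m, u, h.trans hu, hm, rfl⟩

theorem gen_mem {m : Word ρ} {u v : P} (h : v ≤ u) (hm : Admissible ρ m.1 u) :
    gen F m u ∈ relSubmodule F ρ v :=
  Submodule.subset_span ⟨m, u, h, hm, rfl⟩

theorem gen_eq_single_add (m : Word ρ) (u : P) :
    gen F m u = Finsupp.single m (X ^ ρ u) +
      ∑ k ∈ Finset.range (ρ u), Finsupp.single (m.snoc u (k + 1)) (X ^ (ρ u - (k + 1))) := by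
  rw [gen, Finset.sum_range_succ', snoc_zero, add_comm, Nat.sub_zero]

theorem gen_sub_single_mem (m : Word ρ) (v : P) :
    gen F m v - Finsupp.single m (X ^ ρ v) ∈ degLT F (Word ρ) (ρ v) := by
  rw [gen_eq_single_add, add_sub_cancel_left]
  refine Submodule.sum_mem _ fun k hk w i hi => ?_
  classical
  rw [Finsupp.single_apply]
  split_ifs
  · rw [coeff_X_pow, if_neg]
    have := Finset.mem_range.1 hk
    omega
  · simp

/-! ### Existence of elements with prescribed leading term -/

section Spanning

variable (F)

/-- The elements congruent to an element of `relSubmodule F ρ v` modulo smaller degree. -/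
noncomputable def reducible (ρ : P → ℕ) (v : P) : Submodule F (Word ρ →₀ F[X]) :=
  (relSubmodule F ρ v).restrictScalars F ⊔ degLT F (Word ρ) (ρ v)

variable {F}

theorem single_mem_reducible_of_lt {m : Word ρ} {v : P} {i : ℕ} (h : i < ρ v) :
    Finsupp.single m (X ^ i) ∈ reducible F ρ v := by
  refine Submodule.mem_sup_right fun w j hj => ?_
  classical
  rw [Finsupp.single_apply]
  split_ifs
  · rw [coeff_X_pow, if_neg (by omega)]
  · simp

theorem X_pow_smul_gen_mem {m : Word ρ} {u v : P} (h : v ≤ u) (hm : Admissible ρ m.1 u) (i : ℕ) :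
    (X ^ i : F[X]) • gen F m u ∈ reducible F ρ v :=
  Submodule.mem_sup_left ((relSubmodule F ρ v).smul_mem _ (gen_mem h hm))

theorem X_pow_smul_gen (m : Word ρ) (u : P) (i : ℕ) :
    (X ^ i : F[X]) • gen F m u = ∑ k ∈ Finset.range (ρ u + 1),
      Finsupp.single (m.snoc u k) (X ^ (i + (ρ u - k))) := by
  rw [gen, Finset.smul_sum]
  refine Finset.sum_congr rfl fun k _ => ?_
  rw [Finsupp.smul_single, smul_eq_mul, pow_add]

/-- A multiple of `gen F m v` trades the top power for lower powers at the words `m(v, k)`, after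
which `v` is again admissible because `v < v` fails. -/
theorem single_mem_reducible_of_admissible {v : P} (i : ℕ) {m : Word ρ}
    (hm : Admissible ρ m.1 v) : Finsupp.single m (X ^ i) ∈ reducible F ρ v := by
  induction i using Nat.strong_induction_on generalizing m with
  | _ i ih =>
    by_cases hi : i < ρ v
    · exact single_mem_reducible_of_lt hi
    obtain ⟨j, rfl⟩ := Nat.exists_eq_add_of_le' (not_lt.1 hi)
    have h := X_pow_smul_gen_mem (F := F) le_rfl hm j
    rw [X_pow_smul_gen, Finset.sum_range_succ', snoc_zero, Nat.sub_zero] at h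
    refine (Submodule.add_mem_iff_right _ (Submodule.sum_mem _ fun k hk => ?_)).1 h
    have hk' := Finset.mem_range.1 hk
    exact ih _ (by omega) (admissible_snoc hm (by omega) (by omega) fun h => absurd h (lt_irrefl _))

/-- If `v` is not admissible after a word, its last letter is `(u, ρ u - ρ v)` with `u > v`, and it
occurs in the generator of `u` with exponent exactly `ρ v`. The other terms are the shorter word,
with a higher exponent (hence the general `i`), and words after which `v` is admissible. -/
theorem single_mem_reducible {v : P} (l : List (P × ℕ)) (hl : IsNormal ρ l) (i : ℕ) :
    Finsupp.single ⟨l, hl⟩ (X ^ (i + ρ v)) ∈ reducible F ρ v := by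
  induction l generalizing i with
  | nil => exact single_mem_reducible_of_admissible _ trivial
  | cons a l ih =>
    by_cases ha : Admissible ρ (a :: l) v
    · exact single_mem_reducible_of_admissible _ ha
    have ha' : v < a.1 ∧ a.2 + ρ v = ρ a.1 := not_not.1 ha
    have h := X_pow_smul_gen_mem (F := F) ha'.1.le hl.2.1 (m := ⟨l, hl.1⟩) i
    rw [X_pow_smul_gen, Finset.sum_eq_add_sum_sdiff_singleton_of_mem
      (Finset.mem_range.2 (Nat.lt_succ_of_le hl.2.2.2)), snoc_mk hl,
      (by omega : ρ a.1 - a.2 = ρ v)] at h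
    refine (Submodule.add_mem_iff_left _ (Submodule.sum_mem _ fun k hk => ?_)).1 h
    obtain ⟨hk1, hk2⟩ := Finset.mem_sdiff.1 hk
    rw [Finset.mem_range] at hk1
    rw [Finset.mem_singleton] at hk2
    rcases Nat.eq_zero_or_pos k with rfl | hk0
    · rw [snoc_zero, (by omega : i + (ρ a.1 - 0) = (i + a.2) + ρ v)]
      exact ih hl.1 _
    · exact single_mem_reducible_of_admissible _
        (admissible_snoc hl.2.1 hk0 (by omega) fun _ => by omega)

theorem exists_sub_mem (v : P) (w : Word ρ) :
    ∃ y ∈ relSubmodule F ρ v, y - Finsupp.single w (X ^ ρ v) ∈ degLT F (Word ρ) (ρ v) := by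
  have h := single_mem_reducible (F := F) (v := v) w.1 w.2 0
  rw [zero_add] at h
  obtain ⟨y, hy, z, hz, hyz⟩ := Submodule.mem_sup.1 h
  refine ⟨y, hy, ?_⟩
  have : y - Finsupp.single w (X ^ ρ v) = -z := by
    rw [show Finsupp.single w (X ^ ρ v : F[X]) = y + z from hyz.symm]; abel
  rw [this]
  exact neg_mem hz

end Spanning

/-! ### Uniqueness of elements with prescribed leading term -/

section Independence

variable (F)

open Classical in
/-- The generator of `relSubmodule F ρ v` with leading word `m`. -/
noncomputable def leadGen (v : P) (m : Word ρ) : Word ρ →₀ F[X] :=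
  if h : Admissible ρ m.1 v then gen F m v else
    match m, h with
    | ⟨[], _⟩, h => absurd trivial h
    | ⟨a :: l, hl⟩, _ => gen F ⟨l, hl.1⟩ a.1

variable {F}

theorem leadGen_of_admissible {v : P} {m : Word ρ} (h : Admissible ρ m.1 v) :
    leadGen F v m = gen F m v := by
  rw [leadGen, dif_pos h]

theorem leadGen_of_not_admissible {v : P} {a : P × ℕ} {l : List (P × ℕ)}
    {hl : IsNormal ρ (a :: l)} (h : ¬ Admissible ρ (a :: l) v) :
    leadGen F v ⟨a :: l, hl⟩ = gen F ⟨l, hl.1⟩ a.1 := by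
  rw [leadGen, dif_neg h]

/-- For `u > v` the leading word is `m` followed by `(u, ρ u - ρ v)`, exactly the kind of word after
which `v` is forbidden; so the generators are indexed by all normal words. -/
theorem exists_leadGen_eq (hlt : ∀ p q : P, p < q → ρ p < ρ q) {u v : P} (h : v ≤ u) {m : Word ρ}
    (hm : Admissible ρ m.1 u) : ∃ m', leadGen F v m' = gen F m u := by
  rcases h.eq_or_lt with rfl | h
  · exact ⟨m, leadGen_of_admissible hm⟩
  · have := hlt _ _ h
    have hn : IsNormal ρ ((u, ρ u - ρ v) :: m.1) := ⟨m.2, hm, by simp; omega, by simp⟩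
    exact ⟨⟨_, hn⟩, leadGen_of_not_admissible fun hc => hc ⟨h, by simp; omega⟩⟩

theorem leadGen_self {v : P} (m : Word ρ) : leadGen F v m m = X ^ ρ v := by
  by_cases h : Admissible ρ m.1 v
  · rw [leadGen_of_admissible h, gen_self F h]
  · obtain ⟨l, hl⟩ := m
    cases l with
    | nil => exact absurd trivial h
    | cons a l =>
      have ha : v < a.1 ∧ a.2 + ρ v = ρ a.1 := not_not.1 h
      have := gen_snoc F (m := ⟨l, hl.1⟩) hl.2.1 hl.2.2.2
      rw [snoc_mk hl] at this
      rw [leadGen_of_not_admissible h, this, (by omega : ρ a.1 - a.2 = ρ v)]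

theorem length_lt_of_admissible {v : P} {m w : Word ρ} (hm : Admissible ρ m.1 v)
    (h : leadGen F v m w ≠ 0) (hne : w ≠ m) :
    m.1.length < w.1.length ∧ Admissible ρ w.1 v := by
  rw [leadGen_of_admissible hm] at h
  obtain ⟨k, hk, rfl⟩ := exists_snoc_of_gen_ne_zero F h
  rcases Nat.eq_zero_or_pos k with rfl | h1
  · exact absurd (snoc_zero _ _) hne
  · exact ⟨by rw [snoc_val hm h1 hk]; simp,
      admissible_snoc hm h1 hk fun h => absurd h (lt_irrefl _)⟩

theorem length_lt_of_not_admissible {v : P} {m w : Word ρ} (hw : ¬ Admissible ρ w.1 v)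
    (h : leadGen F v m w ≠ 0) (hne : w ≠ m) :
    w.1.length < m.1.length ∧ ¬ Admissible ρ m.1 v := by
  by_cases hm : Admissible ρ m.1 v
  · exact absurd (length_lt_of_admissible hm h hne).2 hw
  refine ⟨?_, hm⟩
  obtain ⟨l, hl⟩ := m
  cases l with
  | nil => exact absurd trivial hm
  | cons a l =>
    have ha : v < a.1 ∧ a.2 + ρ v = ρ a.1 := not_not.1 hm
    rw [leadGen_of_not_admissible hm] at h
    obtain ⟨k, hk, rfl⟩ := exists_snoc_of_gen_ne_zero F h
    rcases Nat.eq_zero_or_pos k with rfl | h1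
    · rw [snoc_zero]; simp
    · refine absurd (admissible_snoc hl.2.1 h1 hk fun _ hc => hne ?_) hw
      rw [(by omega : k = a.2), snoc_mk hl]

/-- When no other generator contributes at `w`, the coordinate there is `X ^ ρ v * y w`, whose
degree is too large unless `y w = 0`. -/
theorem coord_mem_degLT {v : P} {y : Word ρ →₀ F[X]} {w : Word ρ}
    (hy : Finsupp.linearCombination F[X] (leadGen F v) y ∈ degLT F (Word ρ) (ρ v))
    (h : ∀ m, m ≠ w → y m ≠ 0 → leadGen F v m w = 0) : y w = 0 := by
  have hw : Finsupp.linearCombination F[X] (leadGen F v) y w = X ^ ρ v * y w := by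
    rw [Finsupp.linearCombination_apply, Finsupp.sum, Finsupp.finsetSum_apply,
      Finset.sum_eq_single w]
    · rw [Finsupp.smul_apply, leadGen_self, smul_eq_mul, mul_comm]
    · intro m hm hne
      rw [Finsupp.smul_apply, h m hne (Finsupp.mem_support_iff.1 hm), smul_zero]
    · intro hn
      rw [Finsupp.notMem_support_iff.1 hn, zero_smul, Finsupp.zero_apply]
  ext i
  have := hy w (i + ρ v) (Nat.le_add_left _ _)
  rwa [hw, coeff_X_pow_mul] at this

/-- The matrix of the generators is triangular for a two-stage order: words after which `v` is
forbidden, longest first, then the others, shortest first. Finite support starts the descending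
stage. -/
theorem eq_zero_of_linearCombination_mem {v : P} {y : Word ρ →₀ F[X]}
    (hy : Finsupp.linearCombination F[X] (leadGen F v) y ∈ degLT F (Word ρ) (ρ v)) : y = 0 := by
  have hbound : ∃ B, ∀ w, y w ≠ 0 → w.1.length < B :=
    ⟨y.support.sup (fun w => w.1.length + 1), fun w hw =>
      Finset.le_sup (f := fun w : Word ρ => w.1.length + 1) (Finsupp.mem_support_iff.2 hw)⟩
  obtain ⟨B, hB⟩ := hbound
  have hbad : ∀ n, ∀ w : Word ρ, B ≤ w.1.length + n → ¬ Admissible ρ w.1 v → y w = 0 := by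
    intro n
    induction n with
    | zero =>
      intro w hw _
      by_contra h
      have := hB w h
      omega
    | succ n ih =>
      intro w hw hbad
      refine coord_mem_degLT hy fun m hne hm => ?_
      by_contra h
      obtain ⟨h1, h2⟩ := length_lt_of_not_admissible hbad h hne.symm
      exact hm (ih m (by omega) h2)
  have hgood : ∀ n, ∀ w : Word ρ, w.1.length = n → y w = 0 := by
    intro n
    induction n using Nat.strong_induction_on with
    | _ n ih =>
      intro w hw
      refine coord_mem_degLT hy fun m hne hm => ?_
      by_contra h
      by_cases ha : Admissible ρ m.1 v
      · exact hm (ih _ (hw ▸ (length_lt_of_admissible ha h hne.symm).1) m rfl)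
      · exact hm (hbad B m (by omega) ha)
  ext w : 1
  exact hgood _ w rfl

end Independence

/-- The submodules attached to the vertices correspond to monic polynomials of degree `ρ v`. -/
theorem isMonic_relSubmodule (hlt : ∀ p q : P, p < q → ρ p < ρ q) (v : P) :
    IsMonic (relSubmodule F ρ v) (ρ v) where
  exists_sub_mem := exists_sub_mem v
  eq_zero := by
    intro y hy hd
    have hle : relSubmodule F ρ v ≤
        LinearMap.range (Finsupp.linearCombination F[X] (leadGen F (ρ := ρ) v)) := by
      refine Submodule.span_le.2 ?_
      rintro _ ⟨m, u, hu, hm, rfl⟩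
      obtain ⟨m', hm'⟩ := exists_leadGen_eq (F := F) hlt hu hm
      exact ⟨Finsupp.single m' 1, by simp [hm']⟩
    obtain ⟨x, rfl⟩ := hle hy
    rw [eq_zero_of_linearCombination_mem hd, map_zero]

end Word

end HasseWord

/-! ### Paths and the action on normal words -/

/-- A function on a poset with bottom which vanishes at the bottom and increases by one along
every covering relation. -/
structure IsGradedBy {P : Type u} [PartialOrder P] [OrderBot P] (ρ : P → ℕ) : Prop where
  bot : ρ ⊥ = 0
  covBy : ∀ p q, p ⋖ q → ρ q = ρ p + 1

section Paths

variable {P : Type u} [PartialOrder P]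

/-- The list of edges is a path from `u` to `w`, possibly empty. -/
def IsPath : List (HasseEdge P) → P → P → Prop
  | [], u, w => u = w
  | e :: l, u, w => e.tail = u ∧ IsPath l e.head w

theorem isPath_of_isChain (l : List (HasseEdge P)) (hne : l ≠ [])
    (h : l.IsChain (fun e e' => e.head = e'.tail)) :
    IsPath l (l.head hne).tail (l.getLast hne).head := by
  induction l with
  | nil => exact absurd rfl hne
  | cons e l ih =>
    cases l with
    | nil => exact ⟨rfl, rfl⟩
    | cons e' l =>
      rw [List.isChain_cons_cons] at h
      refine ⟨rfl, ?_⟩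
      rw [h.1]
      exact ih (by simp) h.2

theorem HassePath.isPath (π : HassePath P) : IsPath π.edges π.tail π.head :=
  isPath_of_isChain π.edges π.ne_nil π.chain

theorem IsPath.exists_hassePath {l : List (HasseEdge P)} {u w : P} (h : IsPath l u w)
    (hne : l ≠ []) : ∃ π : HassePath P, π.edges = l ∧ π.tail = u ∧ π.head = w := by
  induction l generalizing u with
  | nil => exact absurd rfl hne
  | cons e l ih =>
    cases l with
    | nil => exact ⟨⟨[e], by simp, by simp⟩, rfl, h.1, h.2⟩
    | cons e' l =>
      obtain ⟨π, h1, h2, h3⟩ := ih h.2 (by simp)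
      refine ⟨⟨e :: e' :: l, by simp, ?_⟩, rfl, h.1, ?_⟩
      · rw [List.isChain_cons_cons]
        exact ⟨h.2.1.symm, h1 ▸ π.chain⟩
      · refine Eq.trans ?_ h3
        simp [HassePath.head, h1]

theorem IsPath.append {l l' : List (HasseEdge P)} {u v w : P} (h : IsPath l u v)
    (h' : IsPath l' v w) : IsPath (l ++ l') u w := by
  induction l generalizing u with
  | nil => cases h; exact h'
  | cons e l ih => exact ⟨h.1, ih h.2⟩

theorem IsPath.map {l : List (HasseEdge P)} {u w : P} (h : IsPath l u w) (f : P ≃o P) :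
    IsPath (l.map (HasseEdge.map f)) (f u) (f w) := by
  induction l generalizing u with
  | nil => exact congrArg f h
  | cons e l ih => exact ⟨congrArg f h.1, ih h.2⟩

theorem exists_isPath [Finite P] {w u : P} (h : w ≤ u) : ∃ l, IsPath l u w := by
  induction u using WellFoundedLT.induction with
  | _ u ih =>
    rcases h.eq_or_lt with rfl | h
    · exact ⟨[], rfl⟩
    · obtain ⟨x, hx, hxu⟩ := exists_le_covBy_of_lt h
      obtain ⟨l, hl⟩ := ih x hxu.lt hx
      exact ⟨⟨(u, x), hxu⟩ :: l, rfl, hl⟩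

variable [OrderBot P] {ρ : P → ℕ}

theorem IsPath.rank_eq (hρ : IsGradedBy ρ) {l : List (HasseEdge P)} {u w : P}
    (h : IsPath l u w) : ρ u = ρ w + l.length := by
  induction l generalizing u with
  | nil => rw [show u = w from h]; rfl
  | cons e l ih =>
    have h1 := hρ.covBy _ _ e.2
    have h2 := ih h.2
    rw [← h.1, HasseEdge.tail, h1, List.length_cons]
    rw [HasseEdge.head] at h2
    omega

theorem IsGradedBy.rank_lt [Finite P] (hρ : IsGradedBy ρ) (p q : P) (h : p < q) : ρ p < ρ q := by
  obtain ⟨l, hl⟩ := exists_isPath h.le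
  have := hl.rank_eq hρ
  cases l with
  | nil => exact absurd h (by rw [show q = p from hl]; exact lt_irrefl _)
  | cons e l => simp only [List.length_cons] at this; omega

/-- The rank is the length of any path to the bottom; hence isomorphisms preserve it. -/
theorem IsGradedBy.eq [Finite P] {ρ' : P → ℕ} (hρ : IsGradedBy ρ) (hρ' : IsGradedBy ρ') (p : P) :
    ρ p = ρ' p := by
  obtain ⟨l, hl⟩ := exists_isPath (bot_le (a := p))
  rw [hl.rank_eq hρ, hl.rank_eq hρ', hρ.bot, hρ'.bot]

theorem IsGradedBy.comp_orderIso {P' : Type*} [PartialOrder P'] [OrderBot P']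
    (hρ : IsGradedBy ρ) (f : P' ≃o P) : IsGradedBy (ρ ∘ f) where
  bot := by simp [hρ.bot]
  covBy p q h := hρ.covBy _ _ ((apply_covBy_apply_iff f).2 h)

theorem IsGradedBy.apply_orderIso [Finite P] (hρ : IsGradedBy ρ) (f : P ≃o P) (p : P) :
    ρ (f p) = ρ p :=
  (hρ.comp_orderIso f).eq hρ p

end Paths

/-! ### The right action of the splitting algebra on normal words -/

namespace SplittingAlgebra

open Polynomial MonicComplement HasseWord MulOpposite

variable (F : Type v) [Field F] {P : Type u} [PartialOrder P]

/-- The polynomial `(t - e₁)⋯(t - eₙ)` of a list of edges over the free algebra. -/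
noncomputable def listPoly (l : List (HasseEdge P)) : (FreeAlgebra F (HasseEdge P))[X] :=
  (l.map fun e => X - C (FreeAlgebra.ι F e)).prod

theorem listPoly_nil : listPoly F ([] : List (HasseEdge P)) = 1 := rfl

theorem listPoly_cons (e : HasseEdge P) (l : List (HasseEdge P)) :
    listPoly F (e :: l) = (X - C (FreeAlgebra.ι F e)) * listPoly F l := by
  simp [listPoly]

theorem listPoly_append (l l' : List (HasseEdge P)) :
    listPoly F (l ++ l') = listPoly F l * listPoly F l' := by
  simp [listPoly]

theorem coeff_listPoly_cons_zero (e : HasseEdge P) (l : List (HasseEdge P)) :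
    (listPoly F (e :: l)).coeff 0 = - (FreeAlgebra.ι F e * (listPoly F l).coeff 0) := by
  rw [listPoly_cons, sub_mul, coeff_sub, coeff_C_mul, coeff_X_mul_zero, zero_sub]

theorem coeff_listPoly_cons_succ (e : HasseEdge P) (l : List (HasseEdge P)) (i : ℕ) :
    (listPoly F (e :: l)).coeff (i + 1) =
      (listPoly F l).coeff i - FreeAlgebra.ι F e * (listPoly F l).coeff (i + 1) := by
  rw [listPoly_cons, sub_mul, coeff_sub, coeff_C_mul, coeff_X_mul]

section Action

variable {F} [OrderBot P] [Finite P] {ρ : P → ℕ} (hρ : IsGradedBy ρ)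

/-- Right multiplication by the polynomial of a vertex, on polynomials over the module spanned by
the normal words. -/
noncomputable def vertexMul (F : Type v) [Field F] (v : P) :
    (Word ρ →₀ F[X]) →ₗ[F[X]] (Word ρ →₀ F[X]) :=
  (Word.isMonic_relSubmodule (F := F) hρ.rank_lt v).mul

theorem exists_edge_factor (e : HasseEdge P) (w : Word ρ) : ∃ r : Word ρ →₀ F,
    vertexMul hρ F e.tail (Finsupp.single w 1) =
      vertexMul hρ F e.head ((X : F[X]) • Finsupp.single w 1 - const r) :=
  IsMonic.exists_linear_factor _ _ (hρ.covBy _ _ e.2) (Word.relSubmodule_antitone e.2.le) w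

/-- The right action of an edge on the module spanned by the normal words. -/
noncomputable def edgeOp (F : Type v) [Field F] (e : HasseEdge P) : Module.End F (Word ρ →₀ F) :=
  Finsupp.linearCombination F fun w => (exists_edge_factor (F := F) hρ e w).choose

theorem edgeOp_single (e : HasseEdge P) (w : Word ρ) (a : F) :
    edgeOp hρ F e (Finsupp.single w a) =
      a • (exists_edge_factor (F := F) hρ e w).choose :=
  Finsupp.linearCombination_single _ _ _

theorem vertexMul_tail (e : HasseEdge P) (m : Word ρ →₀ F) :
    vertexMul hρ F e.tail (const m) =
      vertexMul hρ F e.head ((X : F[X]) • const m - const (edgeOp hρ F e m)) := by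
  induction m using Finsupp.induction_linear with
  | zero => simp only [map_zero, smul_zero, sub_zero]
  | add m m' h h' =>
    rw [map_add, map_add, map_add, map_add, h, h', ← map_add, smul_add]
    congr 1
    abel
  | single w a =>
    have hs : const (Finsupp.single w a) = (C a : F[X]) • Finsupp.single w (1 : F[X]) := by
      rw [← const_single, ← const_smul, Finsupp.smul_single, smul_eq_mul, mul_one]
    rw [edgeOp_single, hs, const_smul, smul_comm, ← smul_sub, map_smul, map_smul]
    exact congrArg (fun y => (C a : F[X]) • y) (exists_edge_factor (F := F) hρ e w).choose_spec

/-- The action of the free algebra on the module spanned by the normal words. -/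
noncomputable def freeAct (F : Type v) [Field F] :
    FreeAlgebra F (HasseEdge P) →ₐ[F] (Module.End F (Word ρ →₀ F))ᵐᵒᵖ :=
  FreeAlgebra.lift F fun e => op (edgeOp hρ F e)

theorem freeAct_ι_mul (e : HasseEdge P) (a : FreeAlgebra F (HasseEdge P)) (m : Word ρ →₀ F) :
    (freeAct hρ F (FreeAlgebra.ι F e * a)).unop m =
      (freeAct hρ F a).unop (edgeOp hρ F e m) := by
  simp [freeAct]

/-- Iterating `M_u = M_w ∘ (X - r)` along the path collects the coefficients of the path polynomial,
acting in the order of the edges. The left side depends only on `u`, which is what forces the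
defining relations. -/
theorem exists_vertexMul_eq {l : List (HasseEdge P)} {u w : P} (h : IsPath l u w)
    (m : Word ρ →₀ F) : ∃ x, vertexMul hρ F u (const m) = vertexMul hρ F w x ∧
      ∀ i, coeffAt i x = (freeAct hρ F ((listPoly F l).coeff i)).unop m := by
  induction l generalizing u m with
  | nil =>
    refine ⟨const m, by rw [show u = w from h], fun i => ?_⟩
    rw [coeffAt_const, listPoly_nil, coeff_one]
    split_ifs <;> simp
  | cons e l ih =>
    obtain ⟨x₁, h1, h1'⟩ := ih h.2 m
    obtain ⟨x₂, h2, h2'⟩ := ih h.2 (edgeOp hρ F e m)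
    refine ⟨(X : F[X]) • x₁ - x₂, ?_, fun i => ?_⟩
    · rw [← h.1, vertexMul_tail, map_sub, map_sub, map_smul, map_smul, h1, h2]
    · rw [map_sub]
      cases i with
      | zero =>
        rw [coeffAt_zero_X_smul, coeff_listPoly_cons_zero, map_neg, unop_neg,
          LinearMap.neg_apply, freeAct_ι_mul, h2', zero_sub]
      | succ i =>
        rw [coeffAt_succ_X_smul, coeff_listPoly_cons_succ, map_sub, unop_sub,
          LinearMap.sub_apply, freeAct_ι_mul, h2', h1']

/-- The right action of the splitting algebra on the module spanned by the normal words. -/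
noncomputable def act (F : Type v) [Field F] :
    SplittingAlgebra F P →ₐ[F] (Module.End F (Word ρ →₀ F))ᵐᵒᵖ :=
  RingQuot.liftAlgHom F ⟨freeAct hρ F, by
    rintro _ _ ⟨π₁, π₂, ht, hh, i⟩
    refine unop_injective (LinearMap.ext fun m => ?_)
    obtain ⟨x₁, h1, h1'⟩ := exists_vertexMul_eq hρ π₁.isPath m
    obtain ⟨x₂, h2, h2'⟩ := exists_vertexMul_eq hρ π₂.isPath m
    -- Both are preimages of the same element under the injective operator of the common head.
    have : x₁ = x₂ := IsMonic.mul_injective _ (show vertexMul hρ F π₁.head x₁ =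
      vertexMul hρ F π₁.head x₂ by rw [← h1, ht, h2, hh])
    exact (h1' i).symm.trans (this ▸ h2' i)⟩

theorem act_mk (a : FreeAlgebra F (HasseEdge P)) :
    act hρ F (RingQuot.mkAlgHom F (SplittingRel F P) a) = freeAct hρ F a := by
  simp [act]

/-- A zero algebra could not act on the nonzero span of the normal words; degrees of monic
polynomials over `A(P)` rely on this. -/
theorem nontrivial_of_isGradedBy {ρ : P → ℕ} (hρ : IsGradedBy ρ) : Nontrivial (SplittingAlgebra F P) := by
  have : Nonempty (Word ρ) := ⟨⟨[], trivial⟩⟩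
  exact (act hρ F).toRingHom.domain_nontrivial

end Action

end SplittingAlgebra

/-! ### Vertex polynomials over the splitting algebra -/

namespace SplittingAlgebra

open Polynomial MonicComplement HasseWord MulOpposite

section Ring

variable {R : Type*} [Ring R]

theorem eq_C_of_coeff_mul_monic {p q : R[X]} {b : R} {d : ℕ} (hp : p.Monic)
    (hd : p.natDegree = d) (h : ∀ i, d ≤ i → (q * p).coeff i = if i = d then b else 0) :
    q = C b := by
  nontriviality R
  subst hd
  rw [← sub_eq_zero]
  by_contra hne
  have h1 : ((q - C b) * p).degree < p.degree := by
    rw [degree_eq_natDegree hp.ne_zero, degree_lt_iff_coeff_zero]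
    intro i hi
    rw [sub_mul, coeff_sub, h i hi, coeff_C_mul]
    split_ifs with hi'
    · rw [hi', hp.coeff_natDegree, mul_one, sub_self]
    · rw [coeff_eq_zero_of_natDegree_lt (by omega), mul_zero, sub_zero]
  rw [hp.degree_mul] at h1
  exact absurd h1 (not_lt.2 (le_add_of_nonneg_left (zero_le_degree_iff.2 hne)))

/-- The terms containing `X` cancel and a monic `p` can be cancelled on the right. -/
theorem eq_mul_of_linear_factor {p : R[X]} {b e r : R} (hp : p.Monic)
    (h : X * (C b * p) = C b * ((X - C e) * p) + C r * p) : r = b * e := by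
  have h1 : C r * p = C (b * e) * p := by
    rw [← sub_eq_iff_eq_add'] at h
    rw [← h, ← mul_assoc, X_mul_C, sub_mul, mul_sub, ← mul_assoc, ← mul_assoc, C_mul,
      sub_sub_cancel, mul_assoc (C b)]
  exact C_injective (hp.isRegular.right h1)

end Ring

section FreeDegree

variable {F : Type v} [Field F] {P : Type u} [PartialOrder P]

theorem one_mem_freeDegree (E : Type u) : (1 : FreeAlgebra F E) ∈ freeDegree F E 0 :=
  Submodule.subset_span ⟨[], rfl, by simp⟩

theorem ι_mem_freeDegree {E : Type u} (e : E) : FreeAlgebra.ι F e ∈ freeDegree F E 1 :=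
  Submodule.subset_span ⟨[e], rfl, by simp⟩

theorem mul_mem_freeDegree {E : Type u} {i j : ℕ} {x y : FreeAlgebra F E}
    (hx : x ∈ freeDegree F E i) (hy : y ∈ freeDegree F E j) :
    x * y ∈ freeDegree F E (i + j) := by
  have h := Submodule.mul_mem_mul hx hy
  rw [freeDegree, freeDegree, Submodule.span_mul_span] at h
  refine Submodule.span_mono ?_ h
  rintro _ ⟨_, ⟨l, hl, rfl⟩, _, ⟨l', hl', rfl⟩, rfl⟩
  exact ⟨l ++ l', by simp [hl, hl'], by simp⟩

theorem coeff_listPoly_eq_zero {l : List (HasseEdge P)} {i : ℕ} (h : l.length < i) :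
    (listPoly F l).coeff i = 0 := by
  induction l generalizing i with
  | nil => rw [listPoly_nil, coeff_one, if_neg (by simp at h; omega)]
  | cons e l ih =>
    rw [List.length_cons] at h
    obtain ⟨i, rfl⟩ := Nat.exists_eq_add_of_le' (show 1 ≤ i by omega)
    rw [coeff_listPoly_cons_succ, ih (by omega), ih (by omega), mul_zero, sub_zero]

theorem coeff_listPoly_mem_freeDegree {l : List (HasseEdge P)} {i : ℕ} (h : i ≤ l.length) :
    (listPoly F l).coeff i ∈ freeDegree F (HasseEdge P) (l.length - i) := by
  induction l generalizing i with
  | nil =>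
    obtain rfl : i = 0 := by simpa using h
    simpa [listPoly_nil] using one_mem_freeDegree _
  | cons e l ih =>
    rw [List.length_cons] at h ⊢
    cases i with
    | zero =>
      rw [coeff_listPoly_cons_zero, Nat.sub_zero, add_comm l.length]
      have h := mul_mem_freeDegree (ι_mem_freeDegree (F := F) e) (ih (Nat.zero_le _))
      exact Submodule.neg_mem _ h
    | succ i =>
      rw [coeff_listPoly_cons_succ, Nat.add_sub_add_right]
      refine sub_mem (ih (by omega)) ?_
      by_cases hi : i + 1 ≤ l.length
      · rw [(by omega : l.length - i = 1 + (l.length - (i + 1)))]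
        exact mul_mem_freeDegree (ι_mem_freeDegree e) (ih hi)
      · rw [coeff_listPoly_eq_zero (by omega), mul_zero]
        exact zero_mem _

end FreeDegree

section PathPoly

variable (F : Type v) [Field F] {P : Type u} [PartialOrder P]

/-- The quotient map from the free algebra on the edges. -/
noncomputable abbrev mk (F : Type v) [Field F] (P : Type u) [PartialOrder P] :
    FreeAlgebra F (HasseEdge P) →ₐ[F] SplittingAlgebra F P :=
  RingQuot.mkAlgHom F (SplittingRel F P)

/-- The polynomial of a list of edges over the splitting algebra. -/
noncomputable def pathPoly (l : List (HasseEdge P)) : (SplittingAlgebra F P)[X] :=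
  (listPoly F l).map (mk F P).toRingHom

theorem coeff_pathPoly (l : List (HasseEdge P)) (i : ℕ) :
    (pathPoly F l).coeff i = mk F P ((listPoly F l).coeff i) := by
  rw [pathPoly, coeff_map]; rfl

theorem pathPoly_nil : pathPoly F ([] : List (HasseEdge P)) = 1 := by
  rw [pathPoly, listPoly_nil, Polynomial.map_one]

theorem pathPoly_append (l l' : List (HasseEdge P)) :
    pathPoly F (l ++ l') = pathPoly F l * pathPoly F l' := by
  rw [pathPoly, listPoly_append, Polynomial.map_mul]; rfl

theorem pathPoly_cons (e : HasseEdge P) (l : List (HasseEdge P)) :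
    pathPoly F (e :: l) = (X - C (mk F P (FreeAlgebra.ι F e))) * pathPoly F l := by
  rw [pathPoly, listPoly_cons, Polynomial.map_mul, Polynomial.map_sub, map_X, map_C]; rfl

theorem pathPoly_monic (l : List (HasseEdge P)) : (pathPoly F l).Monic := by
  induction l with
  | nil => rw [pathPoly_nil]; exact monic_one
  | cons e l ih => rw [pathPoly_cons]; exact (monic_X_sub_C _).mul ih

theorem natDegree_pathPoly [Nontrivial (SplittingAlgebra F P)] (l : List (HasseEdge P)) :
    (pathPoly F l).natDegree = l.length := by
  induction l with
  | nil => rw [pathPoly_nil]; simp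
  | cons e l ih =>
    rw [pathPoly_cons, (monic_X_sub_C _).natDegree_mul (pathPoly_monic F l), ih,
      natDegree_X_sub_C, List.length_cons, add_comm]

variable [OrderBot P] {ρ : P → ℕ}

theorem IsPath.pathPoly_eq (hρ : IsGradedBy ρ) {l l' : List (HasseEdge P)} {u w : P}
    (h : IsPath l u w) (h' : IsPath l' u w) : pathPoly F l = pathPoly F l' := by
  have hlen := h.rank_eq hρ
  rw [h'.rank_eq hρ, Nat.add_left_cancel_iff] at hlen
  -- The defining relations concern nonempty paths only; equal length disposes of empty ones.
  by_cases hl : l = []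
  · subst hl
    rw [List.length_nil, List.length_eq_zero_iff] at hlen
    rw [hlen]
  · obtain ⟨π, rfl, ht, hh⟩ := h.exists_hassePath hl
    obtain ⟨π', rfl, ht', hh'⟩ := h'.exists_hassePath fun h => hl (by simpa [h] using hlen.symm)
    ext i
    rw [coeff_pathPoly, coeff_pathPoly]
    exact RingQuot.mkAlgHom_rel F (SplittingRel.coeff π π' (ht.trans ht'.symm)
      (hh.trans hh'.symm) i)

variable [Finite P]

/-- A path from a vertex to the bottom. -/
noncomputable def pathToBot (v : P) : List (HasseEdge P) :=
  (exists_isPath (bot_le (a := v))).choose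

theorem isPath_pathToBot (v : P) : IsPath (pathToBot v) v ⊥ :=
  (exists_isPath (bot_le (a := v))).choose_spec

theorem length_pathToBot (hρ : IsGradedBy ρ) (v : P) : (pathToBot v).length = ρ v := by
  have := (isPath_pathToBot v).rank_eq hρ
  rw [hρ.bot] at this
  omega

/-- The polynomial of the paths from a vertex to the bottom. -/
noncomputable def vertexPoly (v : P) : (SplittingAlgebra F P)[X] := pathPoly F (pathToBot v)

theorem vertexPoly_eq_mul (hρ : IsGradedBy ρ) {l : List (HasseEdge P)} {u v : P}
    (h : IsPath l u v) : vertexPoly F u = pathPoly F l * vertexPoly F v := by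
  rw [vertexPoly, vertexPoly, ← pathPoly_append]
  exact IsPath.pathPoly_eq F hρ (isPath_pathToBot u) (h.append (isPath_pathToBot v))

theorem vertexPoly_tail (hρ : IsGradedBy ρ) (e : HasseEdge P) : vertexPoly F e.tail =
    (X - C (mk F P (FreeAlgebra.ι F e))) * vertexPoly F e.head := by
  rw [vertexPoly_eq_mul F hρ (l := [e]) (v := e.head) ⟨rfl, rfl⟩, pathPoly_cons, pathPoly_nil,
    mul_one]

theorem natDegree_vertexPoly (hρ : IsGradedBy ρ) (v : P) : (vertexPoly F v).natDegree = ρ v := by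
  have := nontrivial_of_isGradedBy (F := F) hρ
  rw [vertexPoly, natDegree_pathPoly, length_pathToBot hρ]

theorem vertexPoly_monic (v : P) : (vertexPoly F v).Monic := pathPoly_monic F _

theorem map_vertexPoly (hρ : IsGradedBy ρ) (f : P ≃o P) (v : P) :
    (vertexPoly F v).map (mapHom F f).toRingHom = vertexPoly F (f v) := by
  have h := (isPath_pathToBot v).map f
  rw [map_bot] at h
  rw [vertexPoly, vertexPoly, IsPath.pathPoly_eq F hρ (isPath_pathToBot (f v)) h]
  generalize pathToBot v = l
  induction l with
  | nil => rw [List.map_nil, pathPoly_nil, Polynomial.map_one]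
  | cons e l ih =>
    have he : (mapHom F f).toRingHom (mk F P (FreeAlgebra.ι F e)) =
        mk F P (FreeAlgebra.ι F (HasseEdge.map f e)) :=
      (mapHom_mk F f _).trans (by simp [freeMap])
    rw [List.map_cons, pathPoly_cons, pathPoly_cons, Polynomial.map_mul, ih, Polynomial.map_sub,
      map_X, map_C, he]

end PathPoly

/-! ### The basis of normal words -/

section Basis

variable (F : Type v) [Field F] {P : Type u} [PartialOrder P] [OrderBot P] [Finite P] {ρ : P → ℕ}

/-- The monomial in the coefficients of the vertex polynomials attached to a word. -/
noncomputable def wordMonomial (ρ : P → ℕ) : List (P × ℕ) → SplittingAlgebra F P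
  | [] => 1
  | a :: l => wordMonomial ρ l * (vertexPoly F a.1).coeff (ρ a.1 - a.2)

theorem wordMonomial_snoc (hρ : IsGradedBy ρ) {m : Word ρ} {v : P} {k : ℕ}
    (h : Admissible ρ m.1 v) (hk : k ≤ ρ v) : wordMonomial F ρ (m.snoc v k).1 =
      wordMonomial F ρ m.1 * (vertexPoly F v).coeff (ρ v - k) := by
  rcases Nat.eq_zero_or_pos k with rfl | h1
  -- For `k = 0` the coefficient is the leading one, so appending the letter must leave the word
  -- unchanged.
  · have : (vertexPoly F v).coeff (ρ v) = 1 := by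
      rw [← natDegree_vertexPoly F hρ v]; exact vertexPoly_monic F v
    rw [Word.snoc_zero, Nat.sub_zero, this, mul_one]
  · rw [Word.snoc_val h h1 hk, wordMonomial]

/-- The linear map from the span of the normal words to the splitting algebra. -/
noncomputable def ofWords (ρ : P → ℕ) : (Word ρ →₀ F) →ₗ[F] SplittingAlgebra F P :=
  Finsupp.linearCombination F fun w => wordMonomial F ρ w.1

theorem ofWords_single (w : Word ρ) (a : F) :
    ofWords F ρ (Finsupp.single w a) = a • wordMonomial F ρ w.1 :=
  Finsupp.linearCombination_single _ _ _

/-- The extension of `ofWords` to polynomials. -/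
noncomputable def polyOfWords (ρ : P → ℕ) : (Word ρ →₀ F[X]) →+ (SplittingAlgebra F P)[X] :=
  Finsupp.liftAddHom fun w => (AddMonoidHom.mulLeft (C (wordMonomial F ρ w.1))).comp
    (mapRingHom (algebraMap F (SplittingAlgebra F P))).toAddMonoidHom

theorem polyOfWords_single (w : Word ρ) (p : F[X]) : polyOfWords F ρ (Finsupp.single w p) =
    C (wordMonomial F ρ w.1) * p.map (algebraMap F (SplittingAlgebra F P)) := by
  simp [polyOfWords]

theorem coeff_polyOfWords (x : Word ρ →₀ F[X]) (i : ℕ) :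
    (polyOfWords F ρ x).coeff i = ofWords F ρ (coeffAt i x) := by
  induction x using Finsupp.induction_linear with
  | zero => simp
  | add x y hx hy => rw [map_add, coeff_add, map_add, map_add, hx, hy]
  | single w p =>
    have : coeffAt i (Finsupp.single w p) = Finsupp.single w (p.coeff i) := by simp [coeffAt]
    rw [polyOfWords_single, this, ofWords_single, coeff_C_mul, coeff_map, Algebra.smul_def,
      Algebra.commutes]

theorem polyOfWords_X_smul (x : Word ρ →₀ F[X]) :
    polyOfWords F ρ ((X : F[X]) • x) = X * polyOfWords F ρ x := by
  ext i
  cases i with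
  | zero => rw [coeff_polyOfWords, coeffAt_zero_X_smul, coeff_X_mul_zero, map_zero]
  | succ i => rw [coeff_polyOfWords, coeffAt_succ_X_smul, coeff_X_mul, coeff_polyOfWords]

theorem polyOfWords_C_smul (a : F) (x : Word ρ →₀ F[X]) :
    polyOfWords F ρ ((C a : F[X]) • x) = C (algebraMap F _ a) * polyOfWords F ρ x := by
  ext i
  have : coeffAt i ((C a : F[X]) • x) = a • coeffAt i x := by ext w; simp
  rw [coeff_polyOfWords, this, map_smul, coeff_C_mul, coeff_polyOfWords, Algebra.smul_def]

theorem polyOfWords_gen (hρ : IsGradedBy ρ) {m : Word ρ} {u : P} (h : Admissible ρ m.1 u) :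
    polyOfWords F ρ (Word.gen F m u) = C (wordMonomial F ρ m.1) * vertexPoly F u := by
  rw [Word.gen, map_sum]
  conv_rhs => rw [(vertexPoly F u).as_sum_range_C_mul_X_pow, natDegree_vertexPoly F hρ,
    ← Finset.sum_range_reflect, Finset.mul_sum]
  refine Finset.sum_congr rfl fun k hk => ?_
  rw [polyOfWords_single, wordMonomial_snoc F hρ h (by simpa [Nat.lt_succ_iff] using hk),
    Polynomial.map_pow, map_X, C_mul, mul_assoc, Nat.add_sub_cancel]

/-- A generator for `u ≥ v` becomes a multiple of `P_u`, and `P_u` has `P_v` as a right factor. -/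
theorem exists_polyOfWords_eq (hρ : IsGradedBy ρ) {v : P} {x : Word ρ →₀ F[X]}
    (hx : x ∈ Word.relSubmodule F ρ v) : ∃ q, polyOfWords F ρ x = q * vertexPoly F v := by
  induction hx using Submodule.span_induction with
  | mem x hx =>
    obtain ⟨m, u, hu, hm, rfl⟩ := hx
    obtain ⟨l, hl⟩ := exists_isPath hu
    exact ⟨_, by rw [polyOfWords_gen F hρ hm, vertexPoly_eq_mul F hρ hl, ← mul_assoc]⟩
  | zero => exact ⟨0, by simp⟩
  | add x y _ _ hx hy =>
    obtain ⟨q, hq⟩ := hx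
    obtain ⟨q', hq'⟩ := hy
    exact ⟨q + q', by rw [map_add, hq, hq', add_mul]⟩
  | smul p x _ hx =>
    obtain ⟨q, hq⟩ := hx
    induction p using Polynomial.induction_on with
    | C a => exact ⟨C (algebraMap F _ a) * q, by rw [polyOfWords_C_smul, hq, mul_assoc]⟩
    | add p p' h h' =>
      obtain ⟨r, hr⟩ := h
      obtain ⟨r', hr'⟩ := h'
      exact ⟨r + r', by rw [add_smul, map_add, hr, hr', add_mul]⟩
    | monomial n a h =>
      obtain ⟨r, hr⟩ := h
      exact ⟨X * r, by
        rw [pow_succ', mul_left_comm, mul_smul, polyOfWords_X_smul, hr, mul_assoc]⟩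

/-- The image is some `q * P_v`; comparing coefficients in degrees at least `ρ v` with the monic
`P_v` leaves only the constant `q`. -/
theorem polyOfWords_vertexMul_const (hρ : IsGradedBy ρ) (v : P) (m : Word ρ →₀ F) :
    polyOfWords F ρ (vertexMul hρ F v (const m)) = C (ofWords F ρ m) * vertexPoly F v := by
  have := nontrivial_of_isGradedBy (F := F) hρ
  have hM := Word.isMonic_relSubmodule (F := F) hρ.rank_lt v
  obtain ⟨q, hq⟩ := exists_polyOfWords_eq F hρ (hM.mul_mem (const m))
  have hd := hM.mul_sub_mem (i := 0) (const_mem_degLT m)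
  have hq' : q = C (ofWords F ρ m) := by
    refine eq_C_of_coeff_mul_monic (vertexPoly_monic F v) (natDegree_vertexPoly F hρ v)
      fun i hi => ?_
    have h2 : coeffAt i (hM.mul (const m)) = coeffAt i ((X ^ ρ v : F[X]) • const m) := by
      rw [← sub_eq_zero, ← map_sub]
      ext w
      exact hd w i (by simpa using hi)
    have h3 : coeffAt i ((X ^ ρ v : F[X]) • const m) = if i = ρ v then m else 0 := by
      obtain ⟨j, rfl⟩ := Nat.exists_eq_add_of_le' hi
      ext w
      rw [coeffAt_apply, Finsupp.smul_apply, smul_eq_mul, coeff_X_pow_mul, const_apply, coeff_C]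
      by_cases hj : j = 0
      · simp [hj]
      · simp [hj]
    rw [← hq, coeff_polyOfWords, h2, h3]
    split_ifs <;> simp
  rw [← hq']
  exact hq

/-- The factorization `M_u = M_w ∘ (X - r)` is carried to `P_u = (X - e) P_w`, and cancelling the
monic `P_w` identifies `r` with right multiplication by `e`. -/
theorem ofWords_edgeOp (hρ : IsGradedBy ρ) (e : HasseEdge P) (m : Word ρ →₀ F) :
    ofWords F ρ (edgeOp hρ F e m) = ofWords F ρ m * mk F P (FreeAlgebra.ι F e) := by
  have h := vertexMul_tail (F := F) hρ e m
  rw [map_sub, map_smul, eq_sub_iff_add_eq] at h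
  have h' := congrArg (polyOfWords F ρ) h
  rw [map_add, polyOfWords_X_smul, polyOfWords_vertexMul_const, polyOfWords_vertexMul_const,
    polyOfWords_vertexMul_const, vertexPoly_tail F hρ] at h'
  exact eq_mul_of_linear_factor (vertexPoly_monic F e.head) h'.symm

theorem ofWords_act (hρ : IsGradedBy ρ) (a : SplittingAlgebra F P) (m : Word ρ →₀ F) :
    ofWords F ρ ((act hρ F a).unop m) = ofWords F ρ m * a := by
  obtain ⟨a, rfl⟩ := RingQuot.mkAlgHom_surjective F (SplittingRel F P) a
  rw [act_mk]
  induction a using FreeAlgebra.induction generalizing m with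
  | grade0 r =>
    rw [AlgHom.commutes, AlgHom.commutes, ← Algebra.commutes, ← Algebra.smul_def,
      MulOpposite.algebraMap_apply, unop_op, Module.algebraMap_end_apply, map_smul]
  | grade1 e =>
    rw [← ofWords_edgeOp F hρ, freeAct, FreeAlgebra.lift_ι_apply, unop_op]
  | mul a b ha hb =>
    rw [map_mul, map_mul, unop_mul, Module.End.mul_apply, hb, ha, mul_assoc]
  | add a b ha hb =>
    rw [map_add, map_add, unop_add, LinearMap.add_apply, map_add, ha, hb, mul_add]

/-- The normal word representing an element of the splitting algebra. -/
noncomputable def toWords (hρ : IsGradedBy ρ) : SplittingAlgebra F P →ₗ[F] (Word ρ →₀ F) where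
  toFun a := (act hρ F a).unop (Finsupp.single ⟨[], trivial⟩ 1)
  map_add' a b := by simp
  map_smul' r a := by simp

theorem ofWords_toWords (hρ : IsGradedBy ρ) (a : SplittingAlgebra F P) :
    ofWords F ρ (toWords F hρ a) = a := by
  refine (ofWords_act F hρ a _).trans ?_
  rw [ofWords_single, one_smul, wordMonomial, one_mul]

/-- At the bottom the operator is the identity, so the coefficients of `M_v m` give the action of
those of `P_v`. By uniqueness `M_v m` is `gen F m v`, whose coefficients are `m` with one letter
appended. -/
theorem act_coeff_vertexPoly (hρ : IsGradedBy ρ) {m : Word ρ} {v : P} (h : Admissible ρ m.1 v)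
    {k : ℕ} (hk : k ≤ ρ v) : (act hρ F ((vertexPoly F v).coeff (ρ v - k))).unop
      (Finsupp.single m 1) = Finsupp.single (m.snoc v k) 1 := by
  obtain ⟨x, hx, hx'⟩ := exists_vertexMul_eq (F := F) hρ (isPath_pathToBot v) (Finsupp.single m 1)
  have h1 : vertexMul hρ F ⊥ x = x := by
    have := Word.isMonic_relSubmodule (F := F) hρ.rank_lt ⊥
    have h0 : ∀ {d} (hM : IsMonic (Word.relSubmodule F ρ ⊥) d), d = 0 → hM.mul x = x := by
      rintro d hM rfl
      exact hM.mul_eq_self x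
    exact h0 _ hρ.bot
  have h2 : vertexMul hρ F v (const (Finsupp.single m 1)) = Word.gen F m v := by
    rw [const_single]
    exact IsMonic.mul_single_eq _ (Word.gen_mem le_rfl h) (Word.gen_sub_single_mem m v)
  rw [h1, h2] at hx
  rw [vertexPoly, coeff_pathPoly, act_mk, ← hx', ← hx, Word.coeffAt_gen F hk]

theorem toWords_wordMonomial (hρ : IsGradedBy ρ) (l : List (P × ℕ)) (hl : IsNormal ρ l) :
    toWords F hρ (wordMonomial F ρ l) = Finsupp.single ⟨l, hl⟩ 1 := by
  induction l with
  | nil =>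
    change (act hρ F 1).unop _ = _
    rw [map_one]; rfl
  | cons a l ih =>
    change (act hρ F (wordMonomial F ρ l * _)).unop _ = _
    rw [map_mul, unop_mul, Module.End.mul_apply]
    have ih' : (act hρ F (wordMonomial F ρ l)).unop (Finsupp.single ⟨[], trivial⟩ 1) =
      Finsupp.single ⟨l, hl.1⟩ 1 := ih hl.1
    rw [ih', act_coeff_vertexPoly F hρ hl.2.1 hl.2.2.2, Word.snoc_mk]

/-- The basis of the splitting algebra indexed by the normal words. -/
noncomputable def wordBasis (hρ : IsGradedBy ρ) :
    Module.Basis (Word ρ) F (SplittingAlgebra F P) :=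
  Module.Basis.ofRepr (LinearEquiv.ofLinearMap (toWords F hρ) (ofWords F ρ)
    (by
      refine Finsupp.lhom_ext' fun w => LinearMap.ext_ring ?_
      change toWords F hρ (ofWords F ρ (Finsupp.single w 1)) = Finsupp.single w 1
      rw [ofWords_single, one_smul, toWords_wordMonomial F hρ w.1 w.2])
    (LinearMap.ext fun a => ofWords_toWords F hρ a))

theorem wordBasis_apply (hρ : IsGradedBy ρ) (w : Word ρ) :
    wordBasis F hρ w = wordMonomial F ρ w.1 := by
  have : wordBasis F hρ w = ofWords F ρ (Finsupp.single w 1) := rfl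
  rw [this, ofWords_single, one_smul]

end Basis

end SplittingAlgebra

/-! ### Weights of words and automorphisms -/

namespace HasseWord

variable {P : Type u}

/-- The sum of the exponents of the letters of a word. -/
def weight (l : List (P × ℕ)) : ℕ := (l.map Prod.snd).sum

theorem weight_cons (a : P × ℕ) (l : List (P × ℕ)) : weight (a :: l) = a.2 + weight l := by
  simp [weight]

variable [PartialOrder P] {ρ : P → ℕ}

/-- The action of a poset automorphism on the letters of a word. -/
def mapLetters (f : P ≃o P) (l : List (P × ℕ)) : List (P × ℕ) := l.map fun a => (f a.1, a.2)

theorem weight_mapLetters (f : P ≃o P) (l : List (P × ℕ)) :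
    weight (mapLetters f l) = weight l := by
  simp [weight, mapLetters, Function.comp_def]

theorem admissible_mapLetters {f : P ≃o P} (hf : ∀ p, ρ (f p) = ρ p) {l : List (P × ℕ)} {v : P}
    (h : Admissible ρ l v) : Admissible ρ (mapLetters f l) (f v) := by
  cases l with
  | nil => trivial
  | cons a l =>
    rintro ⟨h1, h2⟩
    exact h ⟨f.lt_iff_lt.1 h1, by simpa [hf] using h2⟩

theorem isNormal_mapLetters {f : P ≃o P} (hf : ∀ p, ρ (f p) = ρ p) {l : List (P × ℕ)}
    (h : IsNormal ρ l) : IsNormal ρ (mapLetters f l) := by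
  induction l with
  | nil => trivial
  | cons a l ih =>
    exact ⟨ih h.1, admissible_mapLetters hf h.2.1, h.2.2.1, (h.2.2.2).trans_eq (hf a.1).symm⟩

theorem mapLetters_eq_self_iff (f : P ≃o P) (l : List (P × ℕ)) :
    mapLetters f l = l ↔ ∀ a ∈ l, f a.1 = a.1 := by
  induction l with
  | nil => simp [mapLetters]
  | cons a l ih =>
    have h : mapLetters f (a :: l) = (f a.1, a.2) :: mapLetters f l := rfl
    rw [h, List.cons.injEq, ih, List.forall_mem_cons, Prod.ext_iff]
    simp

/-- The normal words of weight `i` all of whose vertices lie in `T`. -/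
def wordsIn (ρ : P → ℕ) (T : Set P) (i : ℕ) : Set (Word ρ) :=
  {w | weight w.1 = i ∧ ∀ a ∈ w.1, a.1 ∈ T}

end HasseWord

theorem LinearMap.trace_eq_card_of_basis {F : Type*} [Field F] {V : Type*} [AddCommMonoid V]
    [Module F V] {ι : Type*} [Finite ι] (b : Module.Basis ι F V) (T : V →ₗ[F] V) (g : ι → ι)
    (h : ∀ i, T (b i) = b (g i)) : LinearMap.trace F V T = (Nat.card {i // g i = i} : F) := by
  classical
  have := Fintype.ofFinite ι
  rw [LinearMap.trace_eq_matrix_trace F b, Matrix.trace, Nat.card_eq_fintype_card,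
    Fintype.card_subtype, Finset.card_filter, Nat.cast_sum]
  refine Finset.sum_congr rfl fun i _ => ?_
  rw [Matrix.diag_apply, LinearMap.toMatrix_apply, h, Module.Basis.repr_self,
    Finsupp.single_apply]
  split_ifs <;> simp

/-! ### Homogeneous bases and the graded trace -/

namespace SplittingAlgebra

open Polynomial HasseWord

section Degree

variable (F : Type v) [Field F] {P : Type u} [PartialOrder P]

theorem mul_mem_degree {i j : ℕ} {x y : SplittingAlgebra F P} (hx : x ∈ degree F P i)
    (hy : y ∈ degree F P j) : x * y ∈ degree F P (i + j) := by
  obtain ⟨x, hx, rfl⟩ := hx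
  obtain ⟨y, hy, rfl⟩ := hy
  exact ⟨x * y, mul_mem_freeDegree hx hy, map_mul (mk F P) x y⟩

/-- The homomorphism multiplying every edge by the variable. -/
noncomputable def freeScale :
    FreeAlgebra F (HasseEdge P) →ₐ[F] (SplittingAlgebra F P)[X] :=
  FreeAlgebra.lift F fun e => monomial 1 (mk F P (FreeAlgebra.ι F e))

theorem freeScale_of_mem {i : ℕ} {x : FreeAlgebra F (HasseEdge P)}
    (hx : x ∈ freeDegree F (HasseEdge P) i) : freeScale F x = monomial i (mk F P x) := by
  induction hx using Submodule.span_induction with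
  | mem x hx =>
    obtain ⟨l, rfl, rfl⟩ := hx
    induction l with
    | nil => rw [List.map_nil, List.prod_nil, map_one, map_one]; rfl
    | cons e l ih =>
      rw [List.map_cons, List.prod_cons, map_mul, map_mul, ih, freeScale,
        FreeAlgebra.lift_ι_apply, monomial_mul_monomial, List.length_cons, add_comm]
  | zero => simp
  | add x y _ _ hx hy => rw [map_add, map_add, hx, hy, map_add]
  | smul r x _ hx => rw [map_smul, map_smul, hx, smul_monomial]

variable [OrderBot P] {ρ : P → ℕ}

/-- The homomorphism recording the degree as the exponent of a variable. -/
noncomputable def scale (hρ : IsGradedBy ρ) :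
    SplittingAlgebra F P →ₐ[F] (SplittingAlgebra F P)[X] :=
  RingQuot.liftAlgHom F ⟨freeScale F, by
    rintro _ _ ⟨π₁, π₂, ht, hh, i⟩
    -- Paths with the same ends have the same length, so the relations are homogeneous.
    have hlen : π₁.edges.length = π₂.edges.length := by
      have h1 := π₁.isPath.rank_eq hρ
      have h2 := π₂.isPath.rank_eq hρ
      rw [ht, hh] at h1
      omega
    change freeScale F ((listPoly F π₁.edges).coeff i) =
      freeScale F ((listPoly F π₂.edges).coeff i)
    by_cases hi : i ≤ π₁.edges.length
    · rw [freeScale_of_mem F (coeff_listPoly_mem_freeDegree hi),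
        freeScale_of_mem F (coeff_listPoly_mem_freeDegree (hlen ▸ hi)), hlen]
      exact congrArg _ (RingQuot.mkAlgHom_rel F (SplittingRel.coeff π₁ π₂ ht hh i))
    · rw [coeff_listPoly_eq_zero (by omega), coeff_listPoly_eq_zero (by omega)]⟩

theorem scale_of_mem (hρ : IsGradedBy ρ) {i : ℕ} {x : SplittingAlgebra F P}
    (hx : x ∈ degree F P i) : scale F hρ x = monomial i x := by
  obtain ⟨x, hx, rfl⟩ := hx
  refine Eq.trans ?_ (freeScale_of_mem F hx)
  simp [scale]

variable [Finite P]

theorem coeff_vertexPoly_mem_degree (hρ : IsGradedBy ρ) {v : P} {k : ℕ} (hk : k ≤ ρ v) :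
    (vertexPoly F v).coeff (ρ v - k) ∈ degree F P k := by
  rw [vertexPoly, coeff_pathPoly]
  have h := coeff_listPoly_mem_freeDegree (F := F) (l := pathToBot v) (i := ρ v - k)
    (by rw [length_pathToBot hρ]; omega)
  rw [length_pathToBot hρ, Nat.sub_sub_self hk] at h
  exact ⟨_, h, rfl⟩

theorem wordMonomial_mem_degree (hρ : IsGradedBy ρ) {l : List (P × ℕ)} (hl : IsNormal ρ l) :
    wordMonomial F ρ l ∈ degree F P (weight l) := by
  induction l with
  | nil => exact ⟨1, one_mem_freeDegree _, map_one (mk F P)⟩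
  | cons a l ih =>
    rw [weight_cons, add_comm]
    exact mul_mem_degree F (ih hl.1) (coeff_vertexPoly_mem_degree F hρ hl.2.2.2)

/-- The basis is homogeneous, so projecting to degree `weight w.1` does not change the coordinate at
`w`; that projection kills `x`. -/
theorem repr_eq_zero_of_mem_degree (hρ : IsGradedBy ρ) {i : ℕ} {x : SplittingAlgebra F P}
    (hx : x ∈ degree F P i) {w : Word ρ} (hw : weight w.1 ≠ i) :
    (wordBasis F hρ).repr x w = 0 := by
  let D : SplittingAlgebra F P →ₗ[F] SplittingAlgebra F P :=
    ((lcoeff (SplittingAlgebra F P) (weight w.1)).restrictScalars F).comp (scale F hρ).toLinearMap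
  have hD : ∀ {j : ℕ} {y : SplittingAlgebra F P}, y ∈ degree F P j →
      D y = if j = weight w.1 then y else 0 := by
    intro j y hy
    change (scale F hρ y).coeff (weight w.1) = _
    rw [scale_of_mem F hρ hy, coeff_monomial]
  have key : ((wordBasis F hρ).coord w).comp D = (wordBasis F hρ).coord w := by
    refine (wordBasis F hρ).ext fun w' => ?_
    rw [LinearMap.comp_apply, wordBasis_apply, hD (wordMonomial_mem_degree F hρ w'.2)]
    split_ifs with h
    · rfl
    · rw [map_zero, ← wordBasis_apply F hρ, Module.Basis.coord_apply, Module.Basis.repr_self,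
        Finsupp.single_eq_of_ne]
      rintro rfl
      exact h rfl
  have h := LinearMap.congr_fun key x
  rw [LinearMap.comp_apply, hD hx, if_neg hw.symm, map_zero] at h
  exact h.symm

/-- The basis of a homogeneous component of the splitting algebra. -/
noncomputable def degreeBasis (hρ : IsGradedBy ρ) (i : ℕ) :
    Module.Basis {w : Word ρ // weight w.1 = i} F (degree F P i) :=
  Module.Basis.mk
    (v := fun w => ⟨wordMonomial F ρ w.1.1, by
      have h := wordMonomial_mem_degree F hρ w.1.2
      rwa [w.2] at h⟩)
    (by
      have h := (wordBasis F hρ).linearIndependent.comp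
        (Subtype.val : {w : Word ρ // weight w.1 = i} → Word ρ) Subtype.val_injective
      refine LinearIndependent.of_comp (degree F P i).subtype ?_
      convert h using 1
      funext w
      exact (wordBasis_apply F hρ w.1).symm)
    (by
      rintro ⟨x, hx⟩ -
      have h : x ∈ Submodule.span F (wordBasis F hρ '' {w | weight w.1 = i}) := by
        rw [Module.Basis.mem_span_image]
        intro w hw
        by_contra hne
        exact Finsupp.mem_support_iff.1 hw (repr_eq_zero_of_mem_degree F hρ hx hne)
      have hs : wordBasis F hρ '' {w | weight w.1 = i} =
          (degree F P i).subtype '' Set.range (fun w : {w : Word ρ // weight w.1 = i} =>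
            (⟨wordMonomial F ρ w.1.1, by
              have h := wordMonomial_mem_degree F hρ w.1.2
              rwa [w.2] at h⟩ : degree F P i)) := by
        rw [← Set.range_comp]
        ext y
        constructor
        · rintro ⟨w, hw, rfl⟩
          exact ⟨⟨w, hw⟩, (wordBasis_apply F hρ w).symm⟩
        · rintro ⟨w, rfl⟩
          exact ⟨w.1, w.2, wordBasis_apply F hρ w.1⟩
      rw [hs, ← Submodule.map_span] at h
      obtain ⟨y, hy, hyx⟩ := h
      rwa [show y = ⟨x, hx⟩ from Subtype.ext hyx] at hy)

theorem degreeBasis_apply (hρ : IsGradedBy ρ) (i : ℕ) (w : {w : Word ρ // weight w.1 = i}) :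
    (degreeBasis F hρ i w : SplittingAlgebra F P) = wordMonomial F ρ w.1.1 := by
  simp [degreeBasis]

/-- Normal words do not involve the field, so finite-dimensionality over `ℚ` suffices. -/
theorem finite_words (hρ : IsGradedBy ρ) (i : ℕ) : Finite {w : Word ρ // weight w.1 = i} :=
  Module.Finite.finite_basis (degreeBasis ℚ hρ i)

theorem mapHom_wordMonomial (hρ : IsGradedBy ρ) (f : P ≃o P) (l : List (P × ℕ)) :
    mapHom F f (wordMonomial F ρ l) = wordMonomial F ρ (mapLetters f l) := by
  induction l with
  | nil => exact map_one _
  | cons a l ih =>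
    have h : mapHom F f ((vertexPoly F a.1).coeff (ρ a.1 - a.2)) =
        (vertexPoly F (f a.1)).coeff (ρ (f a.1) - a.2) := by
      rw [← map_vertexPoly F hρ, coeff_map, hρ.apply_orderIso]; rfl
    have h' : mapLetters f (a :: l) = (f a.1, a.2) :: mapLetters f l := rfl
    rw [wordMonomial, map_mul, ih, h, h', wordMonomial]

/-- The automorphism permutes the basis words of weight `i`, and a word is fixed exactly when each
of its vertices is. -/
theorem coeff_gradedTrace (hρ : IsGradedBy ρ) (f : P ≃o P) (i : ℕ) :
    PowerSeries.coeff i (gradedTrace F f) = ((wordsIn ρ {p | f p = p} i).ncard : F) := by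
  have := finite_words hρ i
  let g : {w : Word ρ // weight w.1 = i} → {w : Word ρ // weight w.1 = i} := fun w =>
    ⟨⟨mapLetters f w.1.1, isNormal_mapLetters (hρ.apply_orderIso f) w.1.2⟩,
      (weight_mapLetters f _).trans w.2⟩
  have hg : ∀ w, g w = w ↔ ∀ a ∈ w.1.1, f a.1 = a.1 := fun w => by
    rw [← mapLetters_eq_self_iff, Subtype.ext_iff, Subtype.ext_iff]
  rw [gradedTrace, PowerSeries.coeff_mk,
    LinearMap.trace_eq_card_of_basis (degreeBasis F hρ i) _ g]
  · congr 1
    rw [← Nat.card_coe_set_eq]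
    refine Nat.card_congr ⟨fun w => ⟨w.1.1, w.1.2, (hg _).1 w.2⟩,
      fun w => ⟨⟨w.1, w.2.1⟩, (hg _).2 w.2.2⟩, fun _ => rfl, fun _ => rfl⟩
  · intro w
    refine Subtype.ext ?_
    rw [degreeBasis_apply, LinearMap.coe_restrict_apply, degreeBasis_apply]
    exact mapHom_wordMonomial F hρ f w.1.1

end Degree

end SplittingAlgebra

/-! ### Counting the words -/

namespace HasseWord

open PowerSeries

variable {P : Type u} [PartialOrder P] {ρ : P → ℕ}

/-- The normal words of weight `i` with all vertices in `T` that may be followed by `v`. -/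
def wordsBefore (ρ : P → ℕ) (T : Set P) (v : P) (i : ℕ) : Set (Word ρ) :=
  {w | w ∈ wordsIn ρ T i ∧ Admissible ρ w.1 v}

/-- The normal words of weight `i` with all vertices in `T` and last letter `a`. -/
def wordsEnding (ρ : P → ℕ) (T : Set P) (a : P × ℕ) (i : ℕ) : Set (Word ρ) :=
  {w | w ∈ wordsIn ρ T i ∧ w.1.head? = some a}

/-- Deleting the last letter is a bijection onto the shorter words that `u` may follow. -/
theorem ncard_wordsEnding {T : Set P} {u : P} (hu : u ∈ T) {k : ℕ} (h1 : 1 ≤ k) (hk : k ≤ ρ u)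
    (i : ℕ) : (wordsEnding ρ T (u, k) i).ncard =
      if k ≤ i then (wordsBefore ρ T u (i - k)).ncard else 0 := by
  split_ifs with hi
  · refine (Set.ncard_congr (fun w _ => w.snoc u k) ?_ ?_ ?_).symm
    · rintro w ⟨⟨hw, hT⟩, ha⟩
      refine ⟨⟨?_, ?_⟩, ?_⟩
      · rw [Word.snoc_val ha h1 hk, weight_cons, hw]
        exact Nat.add_sub_cancel' hi
      · rw [Word.snoc_val ha h1 hk]
        exact List.forall_mem_cons.2 ⟨hu, hT⟩
      · rw [Word.snoc_val ha h1 hk]; rfl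
    · rintro w w' ⟨-, ha⟩ ⟨-, ha'⟩ h
      have h' := congrArg Subtype.val h
      rw [Word.snoc_val ha h1 hk, Word.snoc_val ha' h1 hk] at h'
      exact Subtype.ext (List.cons_injective h')
    · rintro ⟨l, hl⟩ ⟨⟨hw, hT⟩, hh⟩
      cases l with
      | nil => simp at hh
      | cons a l =>
        obtain rfl : a = (u, k) := by simpa using hh
        have hT' := List.forall_mem_cons.1 hT
        refine ⟨⟨l, hl.1⟩, ⟨⟨?_, hT'.2⟩, hl.2.1⟩, Word.snoc_mk hl⟩
        have : k + weight l = i := by rw [← hw, weight_cons]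
        simp only
        omega
  · convert Set.ncard_empty (Word ρ)
    refine Set.eq_empty_of_forall_notMem ?_
    rintro ⟨l, hl⟩ ⟨⟨hw, -⟩, hh⟩
    cases l with
    | nil => simp at hh
    | cons a l =>
      obtain rfl : a = (u, k) := by simpa using hh
      rw [weight_cons] at hw
      simp only at hw
      omega

theorem disjoint_wordsEnding {T : Set P} {a b : P × ℕ} (hab : a ≠ b) (i : ℕ) :
    Disjoint (wordsEnding ρ T a i) (wordsEnding ρ T b i) := by
  refine Set.disjoint_left.2 ?_
  rintro w ⟨-, h⟩ ⟨-, h'⟩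
  exact hab (Option.some_injective _ (h.symm.trans h'))

section Series

variable {ι : Type*} [Fintype ι] [PartialOrder ι] (θ : ι ↪o P)

theorem finite_wordsIn (hfin : ∀ i, Finite {w : Word ρ // weight w.1 = i}) (T : Set P) (i : ℕ) :
    (wordsIn ρ T i).Finite :=
  (Set.finite_coe_iff.1 (hfin i) : {w : Word ρ | weight w.1 = i}.Finite).subset fun _ hw => hw.1

-- The words that `v` may not follow are those whose last letter is `(u, ρ u - ρ v)` with `u > v`;
-- for different `u` they are disjoint.
open Classical in
theorem ncard_wordsIn_eq_add (hlt : ∀ p q : P, p < q → ρ p < ρ q)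
    (hfin : ∀ i, Finite {w : Word ρ // weight w.1 = i}) (v : P) (i : ℕ) :
    (wordsIn ρ (Set.range θ) i).ncard = (wordsBefore ρ (Set.range θ) v i).ncard +
      ∑ s, if v < θ s then
        (wordsEnding ρ (Set.range θ) (θ s, ρ (θ s) - ρ v) i).ncard else 0 := by
  have hF := finite_wordsIn hfin (Set.range θ) i
  let U : ι → Set (Word ρ) := fun s =>
    if v < θ s then wordsEnding ρ (Set.range θ) (θ s, ρ (θ s) - ρ v) i else ∅
  have hU : ∀ s w, w ∈ U s ↔ v < θ s ∧
      w ∈ wordsEnding ρ (Set.range θ) (θ s, ρ (θ s) - ρ v) i := by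
    intro s w
    simp only [U]
    split_ifs with h <;> simp [h]
  have hUF : ∀ s, (U s).Finite := fun s => hF.subset fun w hw => ((hU s w).1 hw).2.1
  have hUc : ∀ s, (U s).ncard = if v < θ s then
      (wordsEnding ρ (Set.range θ) (θ s, ρ (θ s) - ρ v) i).ncard else 0 := by
    intro s
    simp only [U]
    split_ifs <;> simp
  have hunion : wordsIn ρ (Set.range θ) i = wordsBefore ρ (Set.range θ) v i ∪ ⋃ s, U s := by
    ext w
    simp only [Set.mem_union, Set.mem_iUnion, hU]
    constructor
    · intro hw
      by_cases ha : Admissible ρ w.1 v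
      · exact Or.inl ⟨hw, ha⟩
      · obtain ⟨l, hl⟩ := w
        cases l with
        | nil => exact absurd trivial ha
        | cons a l =>
          have ha' : v < a.1 ∧ a.2 + ρ v = ρ a.1 := not_not.1 ha
          obtain ⟨s, hs⟩ := hw.2 a (by simp)
          refine Or.inr ⟨s, hs ▸ ha'.1, hw, ?_⟩
          rw [hs, ← ha'.2, Nat.add_sub_cancel]
          rfl
    · rintro (hw | ⟨s, -, hw⟩) <;> exact hw.1
  rw [hunion, Set.ncard_union_eq ?_ (hF.subset fun w hw => hw.1) (Set.finite_iUnion hUF),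
    Set.ncard_iUnion_of_finite hUF, finsum_eq_sum_of_fintype]
  · simp_rw [hUc]
  · intro s s' hne
    refine Set.disjoint_left.2 fun w hw hw' => hne (θ.injective ?_)
    have h := ((hU s w).1 hw).2.2.symm.trans ((hU s' w).1 hw').2.2
    exact congrArg Prod.fst (Option.some_injective _ h)
  · refine Set.disjoint_left.2 fun w hw hw' => ?_
    obtain ⟨s, hs⟩ := Set.mem_iUnion.1 hw'
    obtain ⟨hv, -, hh⟩ := (hU s w).1 hs
    obtain ⟨l, hl⟩ := w
    cases l with
    | nil => simp at hh
    | cons a l =>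
      obtain rfl : a = (θ s, ρ (θ s) - ρ v) := by simpa using hh
      exact hw.2 ⟨hv, Nat.sub_add_cancel (hlt _ _ hv).le⟩

theorem ncard_wordsIn_eq_sum (hfin : ∀ i, Finite {w : Word ρ // weight w.1 = i}) (i : ℕ) :
    (wordsIn ρ (Set.range θ) i).ncard = (if i = 0 then 1 else 0) +
      ∑ s, ∑ k : Fin (ρ (θ s)), (wordsEnding ρ (Set.range θ) (θ s, (k : ℕ) + 1) i).ncard := by
  have hF := finite_wordsIn hfin (Set.range θ) i
  let U : (Σ s : ι, Fin (ρ (θ s))) → Set (Word ρ) := fun a =>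
    wordsEnding ρ (Set.range θ) (θ a.1, (a.2 : ℕ) + 1) i
  let E : Set (Word ρ) := {w | w.1 = [] ∧ i = 0}
  have hUF : ∀ s, (U s).Finite := fun s => hF.subset fun w hw => hw.1
  have hE : E.ncard = if i = 0 then 1 else 0 := by
    split_ifs with h
    · rw [Set.ncard_eq_one]
      refine ⟨⟨[], trivial⟩, ?_⟩
      ext w
      simp [E, h, Subtype.ext_iff]
    · simp [E, h]
  have hunion : wordsIn ρ (Set.range θ) i = E ∪ ⋃ a, U a := by
    ext w
    simp only [Set.mem_union, Set.mem_iUnion]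
    constructor
    · intro hw
      obtain ⟨l, hl⟩ := w
      cases l with
      | nil => exact Or.inl ⟨rfl, hw.1.symm⟩
      | cons a l =>
        obtain ⟨s, hs⟩ := hw.2 a (by simp)
        have h1 := hl.2.2.1
        have h2 := hl.2.2.2
        refine Or.inr ⟨⟨s, ⟨a.2 - 1, by rw [hs]; omega⟩⟩, hw, ?_⟩
        simp only [List.head?_cons, Nat.sub_add_cancel h1, hs]
    · rintro (⟨hw, hi⟩ | ⟨s, hw⟩)
      · exact ⟨by rw [hw, hi]; rfl, by rw [hw]; simp⟩
      · exact hw.1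
  rw [hunion, Set.ncard_union_eq ?_ (hF.subset (hunion ▸ Set.subset_union_left))
    (Set.finite_iUnion hUF), Set.ncard_iUnion_of_finite hUF, finsum_eq_sum_of_fintype,
    Fintype.sum_sigma, hE]
  · rintro ⟨s, k⟩ ⟨s', k'⟩ hne
    refine disjoint_wordsEnding (fun h => hne ?_) i
    simp only [Prod.mk.injEq, Nat.add_right_cancel_iff] at h
    obtain rfl := θ.injective h.1
    rw [Fin.ext h.2]
  · refine Set.disjoint_left.2 fun w hw hw' => ?_
    obtain ⟨s, hs⟩ := Set.mem_iUnion.1 hw'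
    have := hs.2
    rw [hw.1] at this
    simp at this

variable (F : Type v) [Field F]

/-- The generating function of the normal words with vertices in `T`. -/
noncomputable def wordSeries (ρ : P → ℕ) (T : Set P) : F⟦X⟧ :=
  PowerSeries.mk fun i => ((wordsIn ρ T i).ncard : F)

/-- The generating function of the normal words with vertices in `T` that may be followed by a
given vertex. -/
noncomputable def beforeSeries (ρ : P → ℕ) (T : Set P) (v : P) : F⟦X⟧ :=
  PowerSeries.mk fun i => ((wordsBefore ρ T v i).ncard : F)

theorem coeff_X_pow_mul_beforeSeries {T : Set P} {u : P} (hu : u ∈ T) {k : ℕ} (h1 : 1 ≤ k)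
    (hk : k ≤ ρ u) (i : ℕ) : coeff i (X ^ k * beforeSeries F ρ T u) =
      ((wordsEnding ρ T (u, k) i).ncard : F) := by
  rw [ncard_wordsEnding hu h1 hk, coeff_X_pow_mul', beforeSeries, coeff_mk]
  split_ifs <;> simp

open Classical in
theorem sum_zeta_mul_beforeSeries (hlt : ∀ p q : P, p < q → ρ p < ρ q)
    (hfin : ∀ i, Finite {w : Word ρ // weight w.1 = i}) (r : ι) :
    ∑ s, (if r ≤ s then X ^ (ρ (θ s) - ρ (θ r)) else 0) * beforeSeries F ρ (Set.range θ) (θ s) =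
      wordSeries F ρ (Set.range θ) := by
  have h : ∀ s, (if r ≤ s then X ^ (ρ (θ s) - ρ (θ r)) else 0) *
      beforeSeries F ρ (Set.range θ) (θ s) =
      (if s = r then beforeSeries F ρ (Set.range θ) (θ r) else 0) + (if θ r < θ s then
        X ^ (ρ (θ s) - ρ (θ r)) * beforeSeries F ρ (Set.range θ) (θ s) else 0) := by
    intro s
    rw [θ.lt_iff_lt]
    rcases eq_or_ne s r with rfl | hne
    · simp
    · simp [hne, lt_iff_le_and_ne, hne.symm]
  simp_rw [h]
  rw [Finset.sum_add_distrib, Finset.sum_ite_eq' Finset.univ r, if_pos (Finset.mem_univ _)]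
  ext i
  rw [map_add, map_sum, wordSeries, coeff_mk, ncard_wordsIn_eq_add θ hlt hfin (θ r), Nat.cast_add,
    Nat.cast_sum, beforeSeries, coeff_mk]
  congr 1
  refine Finset.sum_congr rfl fun s _ => ?_
  split_ifs with hs
  · have := hlt _ _ hs
    exact coeff_X_pow_mul_beforeSeries F (Set.mem_range_self s) (by omega) (by omega) i
  · simp

theorem wordSeries_eq_one_add (hfin : ∀ i, Finite {w : Word ρ // weight w.1 = i}) :
    wordSeries F ρ (Set.range θ) = 1 + ∑ s, (∑ k ∈ Finset.range (ρ (θ s)), X ^ (k + 1)) *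
      beforeSeries F ρ (Set.range θ) (θ s) := by
  ext i
  rw [map_add, map_sum, wordSeries, coeff_mk, ncard_wordsIn_eq_sum θ hfin, Nat.cast_add,
    Nat.cast_sum, coeff_one]
  congr 1
  · split_ifs <;> simp
  · refine Finset.sum_congr rfl fun s _ => ?_
    rw [Finset.sum_mul, map_sum, Nat.cast_sum, Finset.sum_range]
    refine Finset.sum_congr rfl fun k _ => ?_
    exact (coeff_X_pow_mul_beforeSeries F (Set.mem_range_self s) (by omega) k.2 i).symm

-- `B` is a left inverse of the weighted zeta matrix, so each `G r` is a row sum of `B` times `H`.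
-- The row of the least element gives `∑ X ^ ρ s G s = H`, which absorbs the geometric sums after
-- multiplication by `1 - X`.
open Classical in
theorem wordSeries_mul_eq (hlt : ∀ p q : P, p < q → ρ p < ρ q)
    (hfin : ∀ i, Finite {w : Word ρ // weight w.1 = i}) {r₀ : ι} (hr₀ : ∀ r, r₀ ≤ r)
    (hρ₀ : ρ (θ r₀) = 0) (B : ι → ι → F⟦X⟧)
    (hB : ∀ r u, ∑ s, B r s * (if s ≤ u then X ^ (ρ (θ u) - ρ (θ s)) else 0) =
      if r = u then 1 else 0) :
    wordSeries F ρ (Set.range θ) * (1 - X * ∑ r, ∑ s, B r s) = 1 - X := by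
  set H := wordSeries F ρ (Set.range θ) with hH
  set G : ι → F⟦X⟧ := fun s => beforeSeries F ρ (Set.range θ) (θ s) with hG
  have hZ : ∀ r, ∑ s, (if r ≤ s then X ^ (ρ (θ s) - ρ (θ r)) else 0) * G s = H :=
    sum_zeta_mul_beforeSeries θ F hlt hfin
  have hinv : ∀ r, G r = (∑ s, B r s) * H := by
    intro r
    calc G r = ∑ u, (if r = u then 1 else 0) * G u := by simp
      _ = ∑ u, ∑ s, B r s * ((if s ≤ u then X ^ (ρ (θ u) - ρ (θ s)) else 0) * G u) := by
        refine Finset.sum_congr rfl fun u _ => ?_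
        rw [← hB r u, Finset.sum_mul]
        exact Finset.sum_congr rfl fun s _ => mul_assoc _ _ _
      _ = (∑ s, B r s) * H := by
        rw [Finset.sum_comm, Finset.sum_mul]
        refine Finset.sum_congr rfl fun s _ => ?_
        rw [← Finset.mul_sum, hZ]
  have hsum : ∑ r, G r = (∑ r, ∑ s, B r s) * H := by
    rw [Finset.sum_mul]
    exact Finset.sum_congr rfl fun r _ => hinv r
  have hbot : ∑ s, X ^ ρ (θ s) * G s = H := by
    rw [← hZ r₀]
    refine Finset.sum_congr rfl fun s _ => ?_
    rw [if_pos (hr₀ s), hρ₀, Nat.sub_zero]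
  have h1 : (1 - X) * H = (1 - X) + X * ((∑ r, ∑ s, B r s) * H) - X * H := by
    conv_lhs => rw [hH, wordSeries_eq_one_add θ F hfin]
    rw [← hsum, ← hbot, mul_add, mul_one, add_sub_assoc, ← mul_sub, ← Finset.sum_sub_distrib,
      Finset.mul_sum, Finset.mul_sum]
    congr 1
    refine Finset.sum_congr rfl fun s _ => ?_
    have : (1 - X) * ∑ k ∈ Finset.range (ρ (θ s)), X ^ (k + 1) = X * (1 - X ^ ρ (θ s) : F⟦X⟧) := by
      simp_rw [pow_succ']
      rw [← Finset.mul_sum, mul_left_comm, mul_neg_geom_sum]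
    rw [← mul_assoc, this, mul_assoc, sub_mul, one_mul]
  linear_combination h1

end Series

end HasseWord

/-! ### Möbius polynomials -/

section Mobius

open PowerSeries

variable {P : Type u} [PartialOrder P] [Fintype P]

open Classical in
/-- The Möbius function of a finite poset. -/
noncomputable def mobius (p q : P) : ℤ :=
  letI : LocallyFiniteOrder P := Fintype.toLocallyFiniteOrder
  IncidenceAlgebra.mu ℤ (α := P) p q

open Classical in
theorem mobiusPoly_eq_sum (ρ : P → ℕ) : mobiusPoly ρ = ∑ p : P, ∑ q : P,
    if p ≤ q then Polynomial.C (mobius p q) * Polynomial.X ^ (ρ q - ρ p) else 0 := rfl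

open Classical in
theorem sum_mobius (p q : P) :
    ∑ x, (if p ≤ x ∧ x ≤ q then mobius p x else 0) = if p = q then 1 else 0 := by
  let : LocallyFiniteOrder P := Fintype.toLocallyFiniteOrder
  rw [← IncidenceAlgebra.sum_Icc_mu_right (𝕜 := ℤ) p q, ← Finset.sum_filter]
  refine Finset.sum_congr ?_ fun _ _ => rfl
  ext x
  simp

variable (F : Type v) [Field F]

open Classical in
/-- The entries of the inverse of the rank-weighted zeta matrix, all ranks multiplied by `c`. -/
noncomputable def mobiusEntry (ρ : P → ℕ) (c : ℕ) (p q : P) : F⟦X⟧ :=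
  if p ≤ q then ((mobius p q : ℤ) : F⟦X⟧) * X ^ (c * (ρ q - ρ p)) else 0

-- For `p ≤ x ≤ q` the exponents add up to one independent of `x`, leaving the defining sum of the
-- Möbius function.
open Classical in
theorem sum_mobiusEntry_mul (ρ : P → ℕ) (hρ : Monotone ρ) (c : ℕ) (p q : P) :
    ∑ x, mobiusEntry F ρ c p x * (if x ≤ q then X ^ (c * (ρ q - ρ x)) else 0) =
      if p = q then 1 else 0 := by
  have h : ∀ x, mobiusEntry F ρ c p x * (if x ≤ q then X ^ (c * (ρ q - ρ x)) else 0) =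
      ((if p ≤ x ∧ x ≤ q then mobius p x else 0 : ℤ) : F⟦X⟧) * X ^ (c * (ρ q - ρ p)) := by
    intro x
    rw [mobiusEntry]
    by_cases h1 : p ≤ x <;> by_cases h2 : x ≤ q
    · have := hρ h1
      have := hρ h2
      rw [if_pos h1, if_pos h2, if_pos ⟨h1, h2⟩, mul_assoc, ← pow_add, ← mul_add,
        (by omega : ρ x - ρ p + (ρ q - ρ x) = ρ q - ρ p)]
    all_goals simp [h1, h2]
  simp_rw [h]
  rw [← Finset.sum_mul, ← Int.cast_sum, sum_mobius]
  split_ifs with hpq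
  · simp [hpq]
  · simp

theorem sum_mobiusEntry (ρ : P → ℕ) (c : ℕ) : ∑ p, ∑ q, mobiusEntry F ρ c p q =
    ((((mobiusPoly ρ).comp (Polynomial.X ^ c)).map (Int.castRingHom F) : Polynomial F) :
      F⟦X⟧) := by
  classical
  rw [mobiusPoly_eq_sum, Polynomial.sum_comp, Polynomial.map_sum,
    ← Polynomial.coeToPowerSeries.ringHom_apply, map_sum]
  refine Finset.sum_congr rfl fun p _ => ?_
  rw [Polynomial.sum_comp, Polynomial.map_sum, map_sum]
  refine Finset.sum_congr rfl fun q _ => ?_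
  rw [mobiusEntry]
  split_ifs
  · have h := map_intCast (Polynomial.coeToPowerSeries.ringHom (R := F)) (mobius p q)
    rw [Polynomial.coeToPowerSeries.ringHom_apply] at h
    simp [pow_mul, h]
  · simp

end Mobius

/-! ### Products of posets and factor shuffles -/

theorem isLeast_of_existsUnique_isMin {Q : Type u} [PartialOrder Q] [Finite Q] {m : Q}
    (hm : ∀ x : Q, IsMin x → x = m) (x : Q) : m ≤ x := by
  obtain ⟨b, hbx, hb⟩ := (Set.toFinite (Set.univ : Set Q)).exists_le_minimal (Set.mem_univ x)
  have hb' : IsMin b := fun y hy => hb.2 (Set.mem_univ y) hy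
  exact hm b hb' ▸ hbx

theorem IsGradedBy.pi {n : ℕ} {Q : Fin n → Type u} [∀ k, PartialOrder (Q k)]
    [∀ k, OrderBot (Q k)] {ρ : ∀ k, Q k → ℕ} (hρ : ∀ k, IsGradedBy (ρ k)) :
    IsGradedBy (fun x : ∀ k, Q k => ∑ k, ρ k (x k)) where
  bot := Finset.sum_eq_zero fun k _ => (hρ k).bot
  covBy p q h := by
    obtain ⟨i, hi, hne⟩ := Pi.covBy_iff.1 h
    rw [← Finset.add_sum_erase _ (fun k => ρ k (q k)) (Finset.mem_univ i),
      ← Finset.add_sum_erase _ (fun k => ρ k (p k)) (Finset.mem_univ i),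
      (hρ i).covBy _ _ hi, Finset.sum_congr rfl fun j hj => by
        rw [← hne j (Finset.ne_of_mem_erase hj)]]
    omega

namespace CopySystem

variable {n : ℕ} {Q : Fin n → Type u} [∀ k, PartialOrder (Q k)] (C : CopySystem Q)

theorem same_pow (σ : C.shuffles) (m : Fin n) (t : ℕ) : C.same m ((σ.1 ^ t) m) :=
  (σ ^ t).2 m

/-- One coordinate of a fixed point determines all those on its cycle. -/
theorem iso_pow_of_fixed (σ : C.shuffles) {p : ∀ k, Q k} (hp : C.shuffle σ p = p) (m : Fin n)
    (t : ℕ) (h : C.same m ((σ.1 ^ t) m)) : C.iso h (p m) = p ((σ.1 ^ t) m) := by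
  induction t with
  | zero => exact C.iso_apply_eq h (by simp) p
  | succ t ih =>
    have h1 := C.same_pow σ m t
    have h2 : (σ.1 ^ (t + 1)) m = σ.1 ((σ.1 ^ t) m) := by rw [pow_succ']; rfl
    -- The index is generalized because `Q l` depends on it.
    have h3 : ∀ l (hl : l = σ.1 ((σ.1 ^ t) m)) (hm : C.same m l), C.iso hm (p m) = p l := by
      rintro l rfl hm
      rw [← C.iso_iso h1 (C.same_apply σ _), ih h1, ← C.shuffle_apply, hp]
    exact h3 _ h2 h

section Fixed

variable (σ : C.shuffles) {r : ℕ} {c : Fin r → Finset (Fin n)} {k : Fin r → Fin n}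
  {idx : Fin n → Fin r}

/-- The fixed point of a factor shuffle with prescribed coordinates, one for every cycle. -/
def diagonal (hsame : ∀ l, C.same (k (idx l)) l) (hidx : ∀ j, idx (k j) = j) :
    (∀ j, Q (k j)) ↪o (∀ l, Q l) :=
  OrderEmbedding.ofMapLEIff (fun x l => C.iso (hsame l) (x (idx l))) fun x y => by
    constructor
    · intro h j
      have hj : ∀ j', j' = j → x j' ≤ y j' → x j ≤ y j := by rintro _ rfl h; exact h
      exact hj _ (hidx j) ((C.iso (hsame (k j))).le_iff_le.1 (h (k j)))
    · exact fun h l => (C.iso (hsame l)).monotone (h _)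

theorem diagonal_apply (hsame : ∀ l, C.same (k (idx l)) l) (hidx : ∀ j, idx (k j) = j)
    (x : ∀ j, Q (k j)) (l : Fin n) :
    C.diagonal hsame hidx x l = C.iso (hsame l) (x (idx l)) := rfl

theorem range_diagonal (hsame : ∀ l, C.same (k (idx l)) l) (hidx : ∀ j, idx (k j) = j)
    (hσ : ∀ l, idx (σ.1 l) = idx l) (hpow : ∀ l, ∃ t : ℕ, (σ.1 ^ t) (k (idx l)) = l) :
    Set.range (C.diagonal hsame hidx) = {p | C.shuffle σ p = p} := by
  ext p
  constructor
  · rintro ⟨x, rfl⟩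
    refine funext fun l => ?_
    obtain ⟨l, rfl⟩ := σ.1.surjective l
    rw [C.shuffle_apply, diagonal_apply, diagonal_apply, C.iso_iso]
    have h : ∀ j j' (e : j = j') (hj : C.same (k j) (σ.1 l)) (hj' : C.same (k j') (σ.1 l)),
        C.iso hj (x j) = C.iso hj' (x j') := by rintro j _ rfl _ _; rfl
    exact h _ _ (hσ l).symm _ _
  · intro hp
    refine ⟨fun j => p (k j), funext fun l => ?_⟩
    obtain ⟨t, ht⟩ := hpow l
    rw [diagonal_apply]
    have h : ∀ l' (e : (σ.1 ^ t) (k (idx l)) = l') (h : C.same (k (idx l)) l'),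
        C.iso h (p (k (idx l))) = p l' := by
      rintro _ rfl h
      exact C.iso_pow_of_fixed σ hp _ t h
    exact h l ht _

/-- The coordinates on one cycle are isomorphic copies of a single element and have equal rank. -/
theorem rank_diagonal [∀ k, OrderBot (Q k)] [∀ k, Finite (Q k)] {ρ : ∀ k, Q k → ℕ}
    (hρ : ∀ k, IsGradedBy (ρ k)) (hsame : ∀ l, C.same (k (idx l)) l)
    (hidx : ∀ j, idx (k j) = j) (hc : ∀ j l, l ∈ c j ↔ idx l = j) (x : ∀ j, Q (k j)) :
    ∑ l, ρ l (C.diagonal hsame hidx x l) = ∑ j, (c j).card * ρ (k j) (x j) := by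
  have h : ∀ l, ρ l (C.diagonal hsame hidx x l) = ρ (k (idx l)) (x (idx l)) := fun l =>
    ((hρ l).comp_orderIso (C.iso (hsame l))).eq (hρ (k (idx l))) (x (idx l))
  simp_rw [h]
  rw [← Finset.sum_fiberwise Finset.univ idx]
  refine Finset.sum_congr rfl fun j _ => ?_
  rw [Finset.sum_congr (g := fun _ => ρ (k j) (x j)) (s₂ := c j) (by ext l; simp [hc]),
    Finset.sum_const, smul_eq_mul]
  intro l hl
  have : ∀ j', j' = j → ρ (k j') (x j') = ρ (k j) (x j) := by rintro _ rfl; rfl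
  exact this _ ((hc j l).1 hl)

end Fixed

end CopySystem

open PowerSeries HasseWord in
/-- The trace of an automorphism fixing exactly the image of a product of graded posets. -/
theorem SplittingAlgebra.gradedTrace_mul_eq (F : Type v) [Field F] {P : Type u} [PartialOrder P]
    [OrderBot P] [Finite P] {ρ : P → ℕ} (hρ : IsGradedBy ρ) (f : P ≃o P) {r : ℕ}
    {R : Fin r → Type u} [∀ j, PartialOrder (R j)] [∀ j, OrderBot (R j)] [∀ j, Fintype (R j)]
    {ρR : ∀ j, R j → ℕ} (hρR : ∀ j, IsGradedBy (ρR j)) (c : Fin r → ℕ)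
    (θ : (∀ j, R j) ↪o P) (hrange : Set.range θ = {p | f p = p})
    (hrank : ∀ x, ρ (θ x) = ∑ j, c j * ρR j (x j)) :
    gradedTrace F f * (1 - X * ∏ j, ((((mobiusPoly (ρR j)).comp (Polynomial.X ^ c j)).map
      (Int.castRingHom F) : Polynomial F) : F⟦X⟧)) = 1 - X := by
  classical
  have hmono : ∀ j, Monotone (ρR j) := fun j =>
    StrictMono.monotone fun a b h => (hρR j).rank_lt a b h
  have htrace : gradedTrace F f = wordSeries F ρ (Set.range θ) := by
    ext i
    rw [coeff_gradedTrace F hρ, wordSeries, coeff_mk, hrange]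
  have hprod : ∏ j, ((((mobiusPoly (ρR j)).comp (Polynomial.X ^ c j)).map
      (Int.castRingHom F) : Polynomial F) : F⟦X⟧) =
      ∑ x : ∀ j, R j, ∑ y : ∀ j, R j, ∏ j, mobiusEntry F (ρR j) (c j) (x j) (y j) := by
    simp_rw [← sum_mobiusEntry, Fintype.prod_sum]
  rw [htrace, hprod]
  refine wordSeries_mul_eq θ F hρ.rank_lt (finite_words hρ) (r₀ := ⊥) (fun _ => bot_le) ?_ _
    fun x y => ?_
  · rw [hrank]
    exact Finset.sum_eq_zero fun j _ => by rw [Pi.bot_apply, (hρR j).bot, mul_zero]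
  -- Order and rank on the fixed points are computed coordinatewise, so the zeta matrix is a product
  -- over the cycles, and the inverses can be multiplied factor by factor.
  · have hz : ∀ s : ∀ j, R j, (if s ≤ y then X ^ (ρ (θ y) - ρ (θ s)) else 0 : F⟦X⟧) =
        ∏ j, if s j ≤ y j then X ^ (c j * (ρR j (y j) - ρR j (s j))) else 0 := by
      intro s
      by_cases h : s ≤ y
      · rw [if_pos h, Finset.prod_congr rfl fun j _ => if_pos (h j), Finset.prod_pow_eq_pow_sum,
          hrank, hrank]
        congr 1
        rw [← Finset.sum_tsub_distrib _ fun j _ => Nat.mul_le_mul_left _ (hmono j (h j))]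
        exact Finset.sum_congr rfl fun j _ => (Nat.mul_sub _ _ _).symm
      · obtain ⟨j, hj⟩ := not_forall.1 h
        rw [if_neg h, Finset.prod_eq_zero (Finset.mem_univ j) (if_neg hj)]
    simp_rw [hz, ← Finset.prod_mul_distrib]
    rw [← Fintype.prod_sum (fun j a => mobiusEntry F (ρR j) (c j) (x j) a *
      if a ≤ y j then X ^ (c j * (ρR j (y j) - ρR j a)) else 0)]
    simp_rw [sum_mobiusEntry_mul F _ (hmono _)]
    rw [Fintype.prod_ite_zero, Finset.prod_const_one]
    simp only [funext_iff]
    congr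

theorem mainTheorem8 (F : Type v) [Field F] {n : ℕ} (Q : Fin n → Type u)
    [∀ k, PartialOrder (Q k)] [∀ k, Fintype (Q k)]
    (ρ : ∀ k, Q k → ℕ) (hρ : ∀ k, IsRankFunction (ρ k))
    (hmin : ∀ k, ∃! m : Q k, IsMin m)
    (C : CopySystem Q) (σ : C.shuffles)
    {r : ℕ} (c : Fin r → Finset (Fin n))
    (hcycle : ∀ j, σ.1.IsCycleOn (c j : Set (Fin n)))
    (hpart : ∀ l : Fin n, ∃! j, l ∈ c j)
    (k : Fin r → Fin n) (hk : ∀ j, k j ∈ c j) :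
    SplittingAlgebra.gradedTrace F (C.shuffle σ) =
      (1 - PowerSeries.X) *
        (1 - PowerSeries.X * ∏ j : Fin r,
          ((((mobiusPoly (ρ (k j))).comp (Polynomial.X ^ (c j).card)).map (Int.castRingHom F) :
            Polynomial F) : PowerSeries F))⁻¹ := by
  -- The denominator has constant coefficient `1`, so its inverse is a genuine one.
  rw [PowerSeries.eq_mul_inv_iff_mul_eq (by simp)]
  choose m hm hm' using hmin
  let : ∀ l, OrderBot (Q l) := fun l =>
    { bot := m l
      bot_le := isLeast_of_existsUnique_isMin (hm' l) }
  have hgr : ∀ l, IsGradedBy (ρ l) := fun l =>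
    ⟨((hρ l).eq_zero_iff _).2 isMin_bot, (hρ l).covBy⟩
  choose idx hidx hidx' using hpart
  have hc : ∀ j l, l ∈ c j ↔ idx l = j := fun j l =>
    ⟨fun h => (hidx' l j h).symm, fun h => h ▸ hidx l⟩
  have hpow : ∀ l, ∃ t : ℕ, (σ.1 ^ t) (k (idx l)) = l := fun l => by
    obtain ⟨t, -, ht⟩ := (hcycle (idx l)).exists_pow_eq (hk (idx l)) (hidx l)
    exact ⟨t, ht⟩
  have hsame : ∀ l, C.same (k (idx l)) l := fun l => by
    obtain ⟨t, ht⟩ := hpow l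
    have h := C.same_pow σ (k (idx l)) t
    rwa [ht] at h
  have hσ : ∀ l, idx (σ.1 l) = idx l := fun l =>
    (hc _ _).1 ((hcycle (idx l)).1.mapsTo (hidx l))
  have hik : ∀ j, idx (k j) = j := fun j => (hc _ _).1 (hk j)
  exact SplittingAlgebra.gradedTrace_mul_eq F (IsGradedBy.pi hgr) (C.shuffle σ)
    (fun j => hgr (k j)) (fun j => (c j).card) (C.diagonal hsame hik)
    (C.range_diagonal σ hsame hik hσ hpow) (C.rank_diagonal hgr hsame hik hc)
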